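/- \textbf{Setting.} Let $d\ge 2$, let $\Omega\subset\mathbb R^d$ be open and bounded with $\Omega=\operatorname{int}\overline\Omega\neq\emptyset$, $\overline\Omega$ connected, and with a boundary made of finitely many flat faces ($\Omega$ need not be convex). Let $\partial\Omega$ be the disjoint union of $\partial\Omega_D,\partial\Omega_R,\partial\Omega_t$. A generalised face is the intersection of an open $(d-1)$-dimensional face of $\Omega$ with one of these three sets; $PC(\partial\Omega)$ denotes the bounded functions, defined at every point of $\partial\Omega$, that are continuous on each generalised face, with the supremum norm. Let $A$ be a non-empty compact metric space, $T>0$, and let $\alpha\mapsto(a^\alpha,b^\alpha,c^\alpha,f^\alpha)$ (with values in $C(\overline\Omega)\times C(\overline\Omega,\mathbb R^d)\times C(\overline\Omega)\times C(\overline\Omega)$) and $\alpha\mapsto(b^\alpha_{\partial\Omega},c^\alpha_{\partial\Omega},g^\alpha)$ (with values in $PC(\partial\Omega,\mathbb R^d)\times PC(\partial\Omega)\times PC(\partial\Omega)$) be continuous for the supremum norms. Let $g\in C(\partial\Omega)$, $v_T\in C(\overline\Omega)$, $v_T=g$ on $\partial\Omega_D$, and $a^\alpha,c^\alpha,c^\alpha_{\partial\Omega},g^\alpha,g,v_T\ge0$.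 For $x\in\partial\Omega$ let $b^\alpha_{\partial\Omega}(x)\in K(x):=\{b:\exists\Lambda>0\ \forall\lambda\in[0,\Lambda]:\ x+\lambda b\in\overline\Omega\}$. Put $L^\alpha(x,q,p,s)=-a^\alpha(x)q-b^\alpha(x)\cdot p+c^\alpha(x)s$, $L^\alpha_{\partial\Omega}(x,p,s)=-b^\alpha_{\partial\Omega}(x)\cdot p+c^\alpha_{\partial\Omega}(x)s$ and \[ F(t,x,q,p,r,s)=\begin{cases}-r+\sup_\alpha(L^\alpha(x,q,p,s)-f^\alpha(x)), & t\in[0,T),\ x\in\Omega,\\ -r+\sup_\alpha(L^\alpha_{\partial\Omega}(x,p,s)-g^\alpha(x)), & t\in[0,T),\ x\in\partial\Omega_t,\\ \sup_\alpha(L^\alpha_{\partial\Omega}(x,p,s)-g^\alpha(x)), & t\in[0,T),\ x\in\partial\Omega_R,\\ s-g(x), & t\in[0,T),\ x\in\partial\Omega_D,\\ s-v_T(x), & t=T,\ x\in\overline\Omega.\end{cases} \] $F^*$ and $F_*$ are the upper and lower semicontinuous envelopes of $F$ on $[0,T]\times\overline\Omega\times\mathbb R\times\mathbb R^d\times\mathbb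 R\times\mathbb R$. \textbf{Discretisation.} For $i\in\mathbb N$ let $\mathcal T_i$ be conforming simplicial meshes of $\overline\Omega$, shape-regular uniformly in $i$, with mesh size tending to $0$, such that every open $(d-1)$-dimensional mesh face in $\partial\Omega$ lies in exactly one generalised face. Let $V_i$ be the space of continuous functions on $\overline\Omega$ that are affine on each element, with nodes $y_i^\ell$, hat functions $\phi_i^\ell$ and $\hat\phi_i^\ell=\phi_i^\ell/\|\phi_i^\ell\|_{L^1(\Omega)}$. Let $h_i>0$, $T/h_i\in\mathbb N$, $h_i\to0$, and $s_i^k=kh_i$ for $0\le k\le T/h_i$. Let $\bar a_i^\alpha,\bar{\bar a}_i^\alpha,\bar c_i^\alpha,\bar{\bar c}_i^\alpha\in C(\overline\Omega)$, $0\le f_i^\alpha\in C(\overline\Omega)$, $\bar b_i^\alpha,\bar{\bar b}_i^\alpha\in C(\overline\Omega,\mathbb R^d)$, $\bar b_{i,\partial\Omega}^\alpha,\bar{\bar b}_{i,\partial\Omega}^\alpha\in PC(\partial\Omega,\mathbb R^d)$ and $\bar c_{i,\partial\Omega}^\alpha,\bar{\bar c}_{i,\partial\Omega}^\alpha,g_i^\alpha\in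 PC(\partial\Omega)$ depend, for each $i$, continuously on $\alpha$ in the supremum norms, and let all coefficients with bars be bounded uniformly in $i$ and $\alpha$. Suppose that, uniformly in $\alpha\in A$ as $i\to\infty$, \[\sup_{\ell:\,y_i^\ell\notin\partial\Omega_D}\|a^\alpha-(\bar a_i^\alpha(y_i^\ell)+\bar{\bar a}_i^\alpha(y_i^\ell))\|_{L^\infty(\operatorname{supp}\hat\phi_i^\ell)}\to0,\] and that $\bar b_i^\alpha+\bar{\bar b}_i^\alpha\to b^\alpha$, $\bar c_i^\alpha+\bar{\bar c}_i^\alpha\to c^\alpha$, $f_i^\alpha\to f^\alpha$ uniformly on $\overline\Omega$ and $\bar b_{i,\partial\Omega}^\alpha+\bar{\bar b}_{i,\partial\Omega}^\alpha\to b^\alpha_{\partial\Omega}$, $\bar c_{i,\partial\Omega}^\alpha+\bar{\bar c}_{i,\partial\Omega}^\alpha\to c^\alpha_{\partial\Omega}$, $g_i^\alpha\to g^\alpha$ uniformly on $\partial\Omega$. On $\partial\Omega_R$ let $\bar b_{i,\partial\Omega}^\alpha=0$, $\bar c_{i,\partial\Omega}^\alpha=0$ and $\bar{\bar c}_{i,\partial\Omega}^\alpha>0$.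 At nodes $y\in\partial\Omega_t\cup\partial\Omega_R$ let $\bar b_{i,\partial\Omega}^\alpha(y),\bar{\bar b}_{i,\partial\Omega}^\alpha(y)\in K(y)$, and let $\partial_{-b}w(y)=\liminf_{\lambda\downarrow0}\frac{w(y)-w(y+\lambda b)}\lambda$ be the lower Dini derivative. With $\langle\cdot,\cdot\rangle$ the $L^2(\Omega)$ inner product, define for $w\in V_i$ and a node $y=y_i^\ell$ \[ (\mathsf E_i^\alpha w)_\ell=\begin{cases}\bar a_i^\alpha(y)\langle\nabla w,\nabla\hat\phi_i^\ell\rangle+\langle-\bar b_i^\alpha\cdot\nabla w+\bar c_i^\alpha w,\hat\phi_i^\ell\rangle, & y\in\Omega,\\ \partial_{-\bar b_{i,\partial\Omega}^\alpha(y)}w(y)+\bar c_{i,\partial\Omega}^\alpha(y)w(y), & y\in\partial\Omega_t\cup\partial\Omega_R,\\ 0, & y\in\partial\Omega_D,\end{cases} \] define $(\mathsf I_i^\alpha w)_\ell$ by the same formulas with double bars for $y\notin\partial\Omega_D$ and by $w(y)$ for $y\in\partial\Omega_D$, and let $(\mathsf F_i^\alpha)_\ell$ be $\langle f_i^\alpha,\hat\phi_i^\ell\rangle$,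 $g_i^\alpha(y)$, $g(y)$ in the three cases. Let $d_iw(s_i^k,y)=(w(s_i^{k+1},y)-w(s_i^k,y))/h_i$ for $y\in\Omega\cup\partial\Omega_t$ and $0$ for $y\in\partial\Omega_R\cup\partial\Omega_D$, and \[F_iw(s_i^k,y_i^\ell)=-d_iw(s_i^k,y_i^\ell)+\sup_{\alpha\in A}\bigl(\mathsf E_i^\alpha w(s_i^{k+1},\cdot)+\mathsf I_i^\alpha w(s_i^k,\cdot)-\mathsf F_i^\alpha\bigr)_\ell .\] Finally let $P_i:C^2(\mathbb R^d)\to V_i$ be linear maps, each continuous for the norm of $W^{1,\infty}(\Omega)$, with $\langle\nabla P_iw,\nabla\hat\phi_i^\ell\rangle=\langle\nabla w,\nabla\hat\phi_i^\ell\rangle$ for all nodes $y_i^\ell\in\Omega$, and such that for some $C$ independent of $i$ and all $w\in C^\infty(\mathbb R^d)$: $\|P_iw\|_{W^{1,\infty}(\Omega)}\le C\|w\|_{W^{1,\infty}(\Omega)}$ and $\|P_iw-w\|_{W^{1,\infty}(\Omega)}\to0$. For $\psi\in C^2(\mathbb R\times\mathbb R^d)$ let $P_i\psi(s,\cdot)=P_i(\psi(s,\cdot))$.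 \textbf{Theorem.} Let $\psi\in C^2(\mathbb R\times\mathbb R^d)$, and let the time steps $s_i^{k(i)}$ and nodes $y_i^{\ell(i)}$ satisfy $s_i^{k(i)}\to t\in[0,T)$ and $y_i^{\ell(i)}\to x\in\overline\Omega$ as $i\to\infty$. Then \[\limsup_{i\to\infty}F_iP_i\psi(s_i^{k(i)},y_i^{\ell(i)})\le F^*\bigl(t,x,\Delta\psi(t,x),\nabla\psi(t,x),\partial_t\psi(t,x),\psi(t,x)\bigr)\] and \[\liminf_{i\to\infty}F_iP_i\psi(s_i^{k(i)},y_i^{\ell(i)})\ge F_*\bigl(t,x,\Delta\psi(t,x),\nabla\psi(t,x),\partial_t\psi(t,x),\psi(t,x)\bigr).\] -/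

import Mathlib

open Set Filter Topology MeasureTheory
open scoped ENNReal NNReal

noncomputable section

namespace HJB

/-- Euclidean space `ℝ^d`. -/
abbrev E (d : ℕ) := EuclideanSpace ℝ (Fin d)

/-! ### Polytopic domains, faces, piecewise continuous boundary functions -/

/-- An affine hyperplane of `ℝ^d`. -/
def IsHyperplane {d : ℕ} (H : AffineSubspace ℝ (E d)) : Prop :=
  (H : Set (E d)).Nonempty ∧ Module.finrank ℝ H.direction + 1 = d

/-- A bounded polytopic domain, possibly non-convex. `Ω` is the open domain, i.e. the interior of
the closed polytope `closure Ω`; its boundary consists of finitely many flat pieces. -/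
structure IsPolytopicDomain {d : ℕ} (Ω : Set (E d)) : Prop where
  isOpen : IsOpen Ω
  nonempty : Ω.Nonempty
  isBounded : Bornology.IsBounded Ω
  isConnected : IsConnected (closure Ω)
  interior_closure : interior (closure Ω) = Ω
  flat_boundary : ∃ 𝓗 : Set (AffineSubspace ℝ (E d)), 𝓗.Finite ∧
    (∀ H ∈ 𝓗, IsHyperplane H) ∧ frontier Ω ⊆ ⋃ H ∈ 𝓗, (H : Set (E d))

/-- The boundary points near which the boundary coincides with the hyperplane `H`. -/
def flatPart {d : ℕ} (Ω : Set (E d)) (H : AffineSubspace ℝ (E d)) : Set (E d) :=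
  {x | x ∈ frontier Ω ∧ ∀ᶠ z in 𝓝 x, (z ∈ frontier Ω ↔ z ∈ H)}

/-- The open `(d-1)`-dimensional faces of `Ω`. -/
def openFaces {d : ℕ} (Ω : Set (E d)) : Set (Set (E d)) :=
  {ω | ∃ H : AffineSubspace ℝ (E d), IsHyperplane H ∧
    ∃ x ∈ flatPart Ω H, ω = connectedComponentIn (flatPart Ω H) x}

/-- The generalised faces: intersections of an open face with one of the three regions of the
boundary. -/
def generalisedFaces {d : ℕ} (Ω ΓD ΓR Γt : Set (E d)) : Set (Set (E d)) :=
  {ω | ∃ ω' ∈ openFaces Ω, ω = ω' ∩ ΓD ∨ ω = ω' ∩ ΓR ∨ ω = ω' ∩ Γt}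

/-- Piecewise continuous functions on the boundary: bounded, and continuous on every generalised
face. They have a value at every boundary point, and their norm is the supremum norm. -/
def IsPC {d : ℕ} {V : Type*} [NormedAddCommGroup V] (Ω ΓD ΓR Γt : Set (E d)) (u : E d → V) :
    Prop :=
  (∃ C : ℝ, ∀ x ∈ frontier Ω, ‖u x‖ ≤ C) ∧
    ∀ ω ∈ generalisedFaces Ω ΓD ΓR Γt, ContinuousOn u ω

/-- `α ↦ u α` is continuous for the supremum norm on `S`. -/
def ContinuousFamily {d : ℕ} {A V : Type*} [TopologicalSpace A] [NormedAddCommGroup V]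
    (S : Set (E d)) (u : A → E d → V) : Prop :=
  ∀ α, TendstoUniformlyOn u (u α) (𝓝 α) S

/-- `sup_α sup_{x ∈ S} ‖u i α x - v α x‖ → 0` as `i → ∞`. -/
def ConvergesUniformly {d : ℕ} {A V : Type*} [NormedAddCommGroup V]
    (S : Set (E d)) (u : ℕ → A → E d → V) (v : A → E d → V) : Prop :=
  TendstoUniformlyOn (fun i (p : A × E d) => u i p.1 p.2) (fun p => v p.1 p.2) atTop
    (univ ×ˢ S)

/-- The tangent cone `K(x)` of the polytope `closure Ω` at `x`. -/
def tangentCone {d : ℕ} (Ω : Set (E d)) (x : E d) : Set (E d) :=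
  {b | ∃ Λ : ℝ, 0 < Λ ∧ ∀ r ∈ Icc (0 : ℝ) Λ, x + r • b ∈ closure Ω}

/-! ### The final time boundary value problem -/

/-- The data of the Bellman problem with mixed boundary conditions. -/
structure Problem (d : ℕ) (A : Type*) [MetricSpace A] where
  /-- the open domain -/
  Ω : Set (E d)
  /-- Dirichlet boundary -/
  ΓD : Set (E d)
  /-- Robin boundary without time derivative -/
  ΓR : Set (E d)
  /-- Robin boundary with time derivative -/
  Γt : Set (E d)
  /-- final time -/
  T : ℝ
  a : A → E d → ℝ
  b : A → E d → E d
  c : A → E d → ℝ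
  f : A → E d → ℝ
  /-- first order coefficient of the Robin operator -/
  bB : A → E d → E d
  /-- zeroth order coefficient of the Robin operator -/
  cB : A → E d → ℝ
  /-- Robin data -/
  gB : A → E d → ℝ
  /-- Dirichlet data -/
  g : E d → ℝ
  /-- final time data -/
  vT : E d → ℝ
  domain : IsPolytopicDomain Ω
  disjoint_DR : Disjoint ΓD ΓR
  disjoint_Dt : Disjoint ΓD Γt
  disjoint_Rt : Disjoint ΓR Γt
  boundary_eq : ΓD ∪ ΓR ∪ Γt = frontier Ω
  T_pos : 0 < T
  a_cont : ∀ α, ContinuousOn (a α) (closure Ω)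
  b_cont : ∀ α, ContinuousOn (b α) (closure Ω)
  c_cont : ∀ α, ContinuousOn (c α) (closure Ω)
  f_cont : ∀ α, ContinuousOn (f α) (closure Ω)
  a_family : ContinuousFamily (closure Ω) a
  b_family : ContinuousFamily (closure Ω) b
  c_family : ContinuousFamily (closure Ω) c
  f_family : ContinuousFamily (closure Ω) f
  bB_pc : ∀ α, IsPC Ω ΓD ΓR Γt (bB α)
  cB_pc : ∀ α, IsPC Ω ΓD ΓR Γt (cB α)
  gB_pc : ∀ α, IsPC Ω ΓD ΓR Γt (gB α)
  bB_family : ContinuousFamily (frontier Ω) bB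
  cB_family : ContinuousFamily (frontier Ω) cB
  gB_family : ContinuousFamily (frontier Ω) gB
  g_cont : ContinuousOn g (frontier Ω)
  vT_cont : ContinuousOn vT (closure Ω)
  a_nonneg : ∀ α, ∀ x ∈ closure Ω, 0 ≤ a α x
  c_nonneg : ∀ α, ∀ x ∈ closure Ω, 0 ≤ c α x
  cB_nonneg : ∀ α, ∀ x ∈ frontier Ω, 0 ≤ cB α x
  gB_nonneg : ∀ α, ∀ x ∈ frontier Ω, 0 ≤ gB α x
  g_nonneg : ∀ x ∈ frontier Ω, 0 ≤ g x
  vT_nonneg : ∀ x ∈ closure Ω, 0 ≤ vT x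
  vT_dirichlet : ∀ x ∈ ΓD, vT x = g x
  bB_cone : ∀ α, ∀ x ∈ frontier Ω, bB α x ∈ tangentCone Ω x

namespace Problem

variable {d : ℕ} {A : Type*} [MetricSpace A] (pb : Problem d A)

/-- The operator `L^α(x,q,p,s)`. -/
def L (α : A) (x : E d) (q : ℝ) (p : E d) (s : ℝ) : ℝ :=
  -(pb.a α x * q) - inner ℝ (pb.b α x) p + pb.c α x * s

/-- The Robin operator `L_{∂Ω}^α(x,p,s)`. -/
def LB (α : A) (x : E d) (p : E d) (s : ℝ) : ℝ :=
  -(inner ℝ (pb.bB α x) p) + pb.cB α x * s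

open Classical in
/-- The operator `F(t,x,q,p,r,s)` of the final time boundary value problem; only its values for
`(t,x) ∈ [0,T] × closure Ω` matter. -/
def F : ℝ × E d × ℝ × E d × ℝ × ℝ → ℝ := fun (t, x, q, p, r, s) =>
  if t = pb.T then s - pb.vT x
  else if x ∈ pb.Ω then -r + ⨆ α, (pb.L α x q p s - pb.f α x)
  else if x ∈ pb.Γt then -r + ⨆ α, (pb.LB α x p s - pb.gB α x)
  else if x ∈ pb.ΓR then ⨆ α, (pb.LB α x p s - pb.gB α x)
  else s - pb.g x

/-- The arguments `(t,x,q,p,r,s)` of `F` with `(t,x) ∈ [0,T] × closure Ω`. -/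
def argSet : Set (ℝ × E d × ℝ × E d × ℝ × ℝ) :=
  {z | z.1 ∈ Icc 0 pb.T ∧ z.2.1 ∈ closure pb.Ω}

/-- The upper semicontinuous envelope `F^*`. -/
def upperF (z : ℝ × E d × ℝ × E d × ℝ × ℝ) : EReal :=
  limsup (fun z' => ((pb.F z' : ℝ) : EReal)) (𝓝[pb.argSet] z)

/-- The lower semicontinuous envelope `F_*`. -/
def lowerF (z : ℝ × E d × ℝ × E d × ℝ × ℝ) : EReal :=
  liminf (fun z' => ((pb.F z' : ℝ) : EReal)) (𝓝[pb.argSet] z)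

end Problem

/-! ### Meshes and finite element spaces -/

/-- The `d`-dimensional elements (closed simplices) of a simplicial complex. -/
def elements {d : ℕ} (K : Geometry.SimplicialComplex ℝ (E d)) : Set (Set (E d)) :=
  {k | ∃ s ∈ K.faces, s.card = d + 1 ∧ k = convexHull ℝ (s : Set (E d))}

/-- The largest diameter of an element. -/
def meshSize {d : ℕ} (K : Geometry.SimplicialComplex ℝ (E d)) : ℝ :=
  sSup (Metric.diam '' elements K)

/-- The open boundary faces: relative interiors of the `(d-1)`-dimensional simplices of the mesh
that lie in the boundary of `Ω`. -/
def boundaryMesh {d : ℕ} (Ω : Set (E d)) (K : Geometry.SimplicialComplex ℝ (E d)) :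
    Set (Set (E d)) :=
  {e | ∃ s ∈ K.faces, s.card = d ∧ convexHull ℝ (s : Set (E d)) ⊆ frontier Ω ∧
    e = intrinsicInterior ℝ (convexHull ℝ (s : Set (E d)))}

/-- `K` is a (conforming, finite) simplicial mesh of `closure Ω` whose boundary mesh is subordinate
to the generalised faces. -/
structure IsMesh {d : ℕ} (Ω ΓD ΓR Γt : Set (E d)) (K : Geometry.SimplicialComplex ℝ (E d)) :
    Prop where
  finite : K.faces.Finite
  pure : ∀ s ∈ K.faces, ∃ s' ∈ K.faces, s ⊆ s' ∧ s'.card = d + 1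
  space_eq : K.space = closure Ω
  subordinate : ∀ e ∈ boundaryMesh Ω K, ∃! ω, ω ∈ generalisedFaces Ω ΓD ΓR Γt ∧ e ⊆ ω

/-- The space of continuous functions on the meshed set which are affine on every element.
To be able to speak of functions on `ℝ^d`, they are extended by zero. -/
def P1 {d : ℕ} (K : Geometry.SimplicialComplex ℝ (E d)) : Submodule ℝ (E d → ℝ) where
  carrier := {w | ContinuousOn w K.space ∧
    (∀ k ∈ elements K, ∃ l : E d →ᵃ[ℝ] ℝ, EqOn w l k) ∧ ∀ x ∉ K.space, w x = 0}
  add_mem' := by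
    rintro u v ⟨hu, hu', hu''⟩ ⟨hv, hv', hv''⟩
    refine ⟨hu.add hv, fun k hk => ?_, fun x hx => by simp [hu'' x hx, hv'' x hx]⟩
    obtain ⟨l, hl⟩ := hu' k hk
    obtain ⟨m, hm⟩ := hv' k hk
    exact ⟨l + m, fun x hx => by simp [hl hx, hm hx]⟩
  zero_mem' := ⟨continuousOn_const, fun k _ => ⟨0, fun x _ => by simp⟩, fun x _ => rfl⟩
  smul_mem' := by
    rintro r u ⟨hu, hu', hu''⟩
    refine ⟨hu.const_smul r, fun k hk => ?_, fun x hx => by simp [hu'' x hx]⟩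
    obtain ⟨l, hl⟩ := hu' k hk
    exact ⟨r • l, fun x hx => by simp [hl hx]⟩

/-- The nodal hat functions: `φ y` is the element of the finite element space which is `1` at the
node `y` and `0` at all other nodes. -/
def IsHatFamily {d : ℕ} (K : Geometry.SimplicialComplex ℝ (E d)) (φ : E d → E d → ℝ) : Prop :=
  ∀ y ∈ K.vertices, φ y ∈ P1 K ∧ φ y y = 1 ∧ ∀ z ∈ K.vertices, z ≠ y → φ y z = 0

/-- The lower Dini derivative `∂_{-b} w(y)`. -/
def dini {d : ℕ} (b : E d) (w : E d → ℝ) (y : E d) : ℝ :=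
  liminf (fun r : ℝ => (w y - w (y + r • b)) / r) (𝓝[>] 0)

/-! ### The discretisation -/

/-- A sequence of discretisations. The suffix `E` marks the explicit and `I` the implicit part of
a coefficient; `B` marks the coefficients of the Robin operators. -/
structure Scheme {d : ℕ} {A : Type*} [MetricSpace A] (pb : Problem d A) where
  mesh : ℕ → Geometry.SimplicialComplex ℝ (E d)
  /-- hat functions -/
  φ : ℕ → E d → E d → ℝ
  /-- time step size -/
  h : ℕ → ℝ
  /-- number of time steps, `T / h` -/
  steps : ℕ → ℕ
  aE : ℕ → A → E d → ℝ
  aI : ℕ → A → E d → ℝ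
  bE : ℕ → A → E d → E d
  bI : ℕ → A → E d → E d
  cE : ℕ → A → E d → ℝ
  cI : ℕ → A → E d → ℝ
  f : ℕ → A → E d → ℝ
  bBE : ℕ → A → E d → E d
  bBI : ℕ → A → E d → E d
  cBE : ℕ → A → E d → ℝ
  cBI : ℕ → A → E d → ℝ
  gB : ℕ → A → E d → ℝ
  -- meshes and time steps
  isMesh : ∀ i, IsMesh pb.Ω pb.ΓD pb.ΓR pb.Γt (mesh i)
  isHat : ∀ i, IsHatFamily (mesh i) (φ i)
  shape_regular : ∃ σ : ℝ, ∀ i, ∀ k ∈ elements (mesh i), ∃ z ρ, 0 < ρ ∧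
    Metric.closedBall z ρ ⊆ k ∧ Metric.diam k ≤ σ * ρ
  meshSize_tendsto : Tendsto (fun i => meshSize (mesh i)) atTop (𝓝 0)
  h_pos : ∀ i, 0 < h i
  h_steps : ∀ i, steps i * h i = pb.T
  h_tendsto : Tendsto h atTop (𝓝 0)
  -- regularity of the coefficients
  aE_cont : ∀ i α, ContinuousOn (aE i α) (closure pb.Ω)
  aI_cont : ∀ i α, ContinuousOn (aI i α) (closure pb.Ω)
  bE_cont : ∀ i α, ContinuousOn (bE i α) (closure pb.Ω)
  bI_cont : ∀ i α, ContinuousOn (bI i α) (closure pb.Ω)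
  cE_cont : ∀ i α, ContinuousOn (cE i α) (closure pb.Ω)
  cI_cont : ∀ i α, ContinuousOn (cI i α) (closure pb.Ω)
  f_cont : ∀ i α, ContinuousOn (f i α) (closure pb.Ω)
  f_nonneg : ∀ i α, ∀ x ∈ closure pb.Ω, 0 ≤ f i α x
  bBE_pc : ∀ i α, IsPC pb.Ω pb.ΓD pb.ΓR pb.Γt (bBE i α)
  bBI_pc : ∀ i α, IsPC pb.Ω pb.ΓD pb.ΓR pb.Γt (bBI i α)
  cBE_pc : ∀ i α, IsPC pb.Ω pb.ΓD pb.ΓR pb.Γt (cBE i α)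
  cBI_pc : ∀ i α, IsPC pb.Ω pb.ΓD pb.ΓR pb.Γt (cBI i α)
  gB_pc : ∀ i α, IsPC pb.Ω pb.ΓD pb.ΓR pb.Γt (gB i α)
  aE_family : ∀ i, ContinuousFamily (closure pb.Ω) (aE i)
  aI_family : ∀ i, ContinuousFamily (closure pb.Ω) (aI i)
  bE_family : ∀ i, ContinuousFamily (closure pb.Ω) (bE i)
  bI_family : ∀ i, ContinuousFamily (closure pb.Ω) (bI i)
  cE_family : ∀ i, ContinuousFamily (closure pb.Ω) (cE i)
  cI_family : ∀ i, ContinuousFamily (closure pb.Ω) (cI i)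
  f_family : ∀ i, ContinuousFamily (closure pb.Ω) (f i)
  bBE_family : ∀ i, ContinuousFamily (frontier pb.Ω) (bBE i)
  bBI_family : ∀ i, ContinuousFamily (frontier pb.Ω) (bBI i)
  cBE_family : ∀ i, ContinuousFamily (frontier pb.Ω) (cBE i)
  cBI_family : ∀ i, ContinuousFamily (frontier pb.Ω) (cBI i)
  gB_family : ∀ i, ContinuousFamily (frontier pb.Ω) (gB i)
  -- the coefficients are bounded uniformly in `i` and `α`
  bounded : ∃ M : ℝ, ∀ i α,
    (∀ x ∈ closure pb.Ω, |aE i α x| ≤ M ∧ |aI i α x| ≤ M ∧ ‖bE i α x‖ ≤ M ∧ ‖bI i α x‖ ≤ M ∧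
      |cE i α x| ≤ M ∧ |cI i α x| ≤ M) ∧
    (∀ x ∈ frontier pb.Ω, ‖bBE i α x‖ ≤ M ∧ ‖bBI i α x‖ ≤ M ∧
      |cBE i α x| ≤ M ∧ |cBI i α x| ≤ M)
  -- the split coefficients approximate the coefficients of the problem
  a_conv : ∀ ε > 0, ∀ᶠ i in atTop, ∀ α, ∀ y ∈ (mesh i).vertices, y ∉ pb.ΓD →
    ∀ x ∈ tsupport (φ i y), |pb.a α x - (aE i α y + aI i α y)| ≤ ε
  b_conv : ConvergesUniformly (closure pb.Ω) (fun i α x => bE i α x + bI i α x) pb.b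
  c_conv : ConvergesUniformly (closure pb.Ω) (fun i α x => cE i α x + cI i α x) pb.c
  f_conv : ConvergesUniformly (closure pb.Ω) f pb.f
  bB_conv : ConvergesUniformly (frontier pb.Ω) (fun i α x => bBE i α x + bBI i α x) pb.bB
  cB_conv : ConvergesUniformly (frontier pb.Ω) (fun i α x => cBE i α x + cBI i α x) pb.cB
  gB_conv : ConvergesUniformly (frontier pb.Ω) gB pb.gB
  -- the Dini derivatives at Robin nodes refer to directions in the tangent cone
  bBE_cone : ∀ i α, ∀ y ∈ (mesh i).vertices, y ∈ pb.Γt ∪ pb.ΓR → bBE i α y ∈ tangentCone pb.Ω y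
  bBI_cone : ∀ i α, ∀ y ∈ (mesh i).vertices, y ∈ pb.Γt ∪ pb.ΓR → bBI i α y ∈ tangentCone pb.Ω y
  -- fully implicit discretisation on the Robin boundary without time derivative
  implicit_R : ∀ i α, ∀ x ∈ pb.ΓR, bBE i α x = 0 ∧ cBE i α x = 0 ∧ 0 < cBI i α x

namespace Scheme

variable {d : ℕ} {A : Type*} [MetricSpace A] {pb : Problem d A} (D : Scheme pb)

/-- The finite element space `V_i`. -/
abbrev V (i : ℕ) : Submodule ℝ (E d → ℝ) := P1 (D.mesh i)

/-- The `k`-th time step. -/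
def s (i k : ℕ) : ℝ := k * D.h i

/-- The hat function at `y`, normalised in `L¹(Ω)`. -/
def φhat (i : ℕ) (y : E d) : E d → ℝ := fun x => D.φ i y x / ∫ z in pb.Ω, |D.φ i y z|

/-- `⟨∇u, ∇v⟩` in `L²(Ω, ℝ^d)`. Functions in `V_i` are differentiable off the null set of
element boundaries. -/
def gradInner (pb : Problem d A) (u v : E d → ℝ) : ℝ :=
  ∫ x in pb.Ω, inner ℝ (gradient u x) (gradient v x)

/-- `a ⟨∇w, ∇η⟩ + ⟨-b ⬝ ∇w + c w, η⟩` -/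
def weakForm (pb : Problem d A) (a : ℝ) (b : E d → E d) (c : E d → ℝ) (w η : E d → ℝ) : ℝ :=
  a * gradInner pb w η + ∫ x in pb.Ω, (-(inner ℝ (b x) (gradient w x)) + c x * w x) * η x

open Classical in
/-- Explicit operator on the domain, row of the node `y`. -/
def opEΩ (i : ℕ) (α : A) (w : E d → ℝ) (y : E d) : ℝ :=
  if y ∈ pb.Ω then weakForm pb (D.aE i α y) (D.bE i α) (D.cE i α) w (D.φhat i y) else 0

open Classical in
/-- Implicit operator on the domain, row of the node `y`. -/
def opIΩ (i : ℕ) (α : A) (w : E d → ℝ) (y : E d) : ℝ :=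
  if y ∈ pb.Ω then weakForm pb (D.aI i α y) (D.bI i α) (D.cI i α) w (D.φhat i y) else 0

open Classical in
/-- Right-hand side on the domain, row of the node `y`. -/
def opFΩ (i : ℕ) (α : A) (y : E d) : ℝ :=
  if y ∈ pb.Ω then ∫ x in pb.Ω, D.f i α x * D.φhat i y x else 0

open Classical in
/-- Explicit operator on the boundary, row of the node `y`. -/
def opEB (i : ℕ) (α : A) (w : E d → ℝ) (y : E d) : ℝ :=
  if y ∈ pb.Γt ∪ pb.ΓR then dini (D.bBE i α y) w y + D.cBE i α y * w y else 0

open Classical in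
/-- Implicit operator on the boundary, row of the node `y`; nodal interpolation on `ΓD`. -/
def opIB (i : ℕ) (α : A) (w : E d → ℝ) (y : E d) : ℝ :=
  if y ∈ pb.Γt ∪ pb.ΓR then dini (D.bBI i α y) w y + D.cBI i α y * w y
  else if y ∈ pb.ΓD then w y else 0

open Classical in
/-- Right-hand side on the boundary, row of the node `y`. -/
def opFB (i : ℕ) (α : A) (y : E d) : ℝ :=
  if y ∈ pb.Γt ∪ pb.ΓR then D.gB i α y else if y ∈ pb.ΓD then pb.g y else 0

/-- `E_i^α` -/
def opE (i : ℕ) (α : A) (w : E d → ℝ) (y : E d) : ℝ := D.opEΩ i α w y + D.opEB i α w y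

/-- `I_i^α` -/
def opI (i : ℕ) (α : A) (w : E d → ℝ) (y : E d) : ℝ := D.opIΩ i α w y + D.opIB i α w y

/-- `F_i^α` -/
def opF (i : ℕ) (α : A) (y : E d) : ℝ := D.opFΩ i α y + D.opFB i α y

open Classical in
/-- The discrete time derivative `d_i w(s_i^k, y)`, which vanishes on `ΓR` and `ΓD`. -/
def dt (i : ℕ) (w : ℝ → E d → ℝ) (k : ℕ) (y : E d) : ℝ :=
  if y ∈ pb.Ω ∪ pb.Γt then (w (D.s i (k + 1)) y - w (D.s i k) y) / D.h i else 0

/-- The operator of the numerical scheme,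
`F_i w = -d_i w + sup_α (E_i^α w(s_i^{k+1}) + I_i^α w(s_i^k) - F_i^α)`, at the node `(s_i^k, y)`. -/
def discreteF (i : ℕ) (w : ℝ → E d → ℝ) (k : ℕ) (y : E d) : ℝ :=
  -(D.dt i w k y) +
    ⨆ α, (D.opE i α (w (D.s i (k + 1))) y + D.opI i α (w (D.s i k)) y - D.opF i α y)

end Scheme

/-! ### Elliptic projections -/

/-- The `C²` functions on `ℝ^d`. -/
def C2 (d : ℕ) : Submodule ℝ (E d → ℝ) where
  carrier := {w | ContDiff ℝ 2 w}
  add_mem' := by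
    intro u v hu hv
    rw [Set.mem_ofPred_eq] at *
    exact hu.add hv
  zero_mem' := by
    rw [Set.mem_ofPred_eq]
    exact contDiff_const
  smul_mem' := by
    intro r u hu
    rw [Set.mem_ofPred_eq] at *
    exact hu.const_smul r

/-- The `W^{1,∞}(Ω)` norm of a function that is locally Lipschitz in `Ω`: for such functions the
weak gradient is the almost everywhere defined classical gradient. -/
def W1inf {d : ℕ} (Ω : Set (E d)) (w : E d → ℝ) : ℝ≥0∞ :=
  eLpNorm w ∞ (volume.restrict Ω) + eLpNorm (gradient w) ∞ (volume.restrict Ω)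

/-- A family of elliptic projections onto the spaces `V_i`. -/
structure EllipticProjection {d : ℕ} {A : Type*} [MetricSpace A] {pb : Problem d A}
    (D : Scheme pb) where
  P : ∀ i, C2 d →ₗ[ℝ] D.V i
  /-- orthogonality at the interior nodes -/
  orthogonal : ∀ i (w : C2 d), ∀ y ∈ (D.mesh i).vertices, y ∈ pb.Ω →
    Scheme.gradInner pb (P i w : E d → ℝ) (D.φhat i y) =
      Scheme.gradInner pb (w : E d → ℝ) (D.φhat i y)
  /-- each single `P_i` is continuous -/
  continuous : ∀ i, ∃ C : ℝ≥0, ∀ w : C2 d,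
    W1inf pb.Ω (P i w : E d → ℝ) ≤ C * W1inf pb.Ω (w : E d → ℝ)
  /-- stability, uniformly in `i`, on smooth functions -/
  stable : ∃ C : ℝ≥0, ∀ i (w : C2 d), ContDiff ℝ ((⊤ : ℕ∞) : WithTop ℕ∞) (w : E d → ℝ) →
    W1inf pb.Ω (P i w : E d → ℝ) ≤ C * W1inf pb.Ω (w : E d → ℝ)
  /-- convergence on smooth functions -/
  tendsto : ∀ w : C2 d, ContDiff ℝ ((⊤ : ℕ∞) : WithTop ℕ∞) (w : E d → ℝ) →
    Tendsto (fun i => W1inf pb.Ω ((P i w : E d → ℝ) - (w : E d → ℝ))) atTop (𝓝 0)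

/-- `ψ(s, ·)` as a `C²` function on `ℝ^d`. -/
def slice {d : ℕ} (ψ : ℝ × E d → ℝ) (hψ : ContDiff ℝ 2 ψ) (s : ℝ) : C2 d :=
  ⟨fun x => ψ (s, x), hψ.comp (contDiff_const.prodMk contDiff_id)⟩

/-- `P_i ψ`, with `P_i` applied at each time separately. -/
def EllipticProjection.apply {d : ℕ} {A : Type*} [MetricSpace A] {pb : Problem d A}
    {D : Scheme pb} (Q : EllipticProjection D) (i : ℕ) (ψ : ℝ × E d → ℝ)
    (hψ : ContDiff ℝ 2 ψ) : ℝ → E d → ℝ :=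
  fun s => (Q.P i (slice ψ hψ s) : E d → ℝ)

/-- `(t, x, Δψ(t,x), ∇ψ(t,x), ∂_tψ(t,x), ψ(t,x))` -/
def jet {d : ℕ} (ψ : ℝ × E d → ℝ) (t : ℝ) (x : E d) : ℝ × E d × ℝ × E d × ℝ × ℝ :=
  (t, x, Laplacian.laplacian (fun z => ψ (t, z)) x, gradient (fun z => ψ (t, z)) x,
    deriv (fun s => ψ (s, x)) t, ψ (t, x))

end HJB

end

namespace HJB

/-! ### Simplicial meshes and finite element functions -/

section Mesh

variable {d : ℕ} {K : Geometry.SimplicialComplex ℝ (E d)} {Ω ΓD ΓR Γt : Set (E d)}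

/-! Freeze every argument of `F` except the space variable at its limit. It suffices that `F_i P_i
ψ` at `(s_i^k, y_i)` minus `F(t, y_i, Δψ(t,x), ∇ψ(t,x), ∂_tψ(t,x), ψ(t,x))` tends to zero
(`tendsto_discreteF_sub_F`): these arguments of `F` converge to the jet at `(t,x)` inside `[0,T] ×
closure Ω`, so the envelopes bound the limsup and liminf. As the node stays inside `F`, boundary
coefficients are compared only at one and the same point. Jumps between faces, and nodes that
alternate between regions, do no harm.

Projections: stability is assumed for smooth functions only, but density together with the
continuity of each single `P_i` extends it to `C²` functions with a constant independent of `i`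
(`exists_C1Bound`). Hence `P_i w_i → u` in `W^{1,∞}` whenever `w_i → u` in `C¹` on the closed
domain, even if `u` is merely `C¹` (`eventually_C1Bound`). This covers the time slices of `ψ` and,
by linearity of `P_i`, the difference quotients in time, whose limit `∂_tψ(t,·)` is in general only
`C¹`.

Interior rows: no second derivative of `P_i ψ` is available. Orthogonality replaces `P_i ψ` by `ψ`
in the diffusion term, and integration by parts turns that term into an average of `-Δψ` over a
shrinking support (`gradInner_φhat`). This needs hat functions of interior nodes to be globally
Lipschitz and to vanish off `Ω`, also for non-convex `Ω`.

Boundary rows: an initial piece of each ray in the tangent cone lies in one element, where the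
function is affine, so the Dini derivative is read off from the gradient on that element
(`exists_element_dini`). That gradient is constant on a set of positive measure, hence controlled by
the essential bounds (`exists_norm_affineGradient_sub_le`).

All row estimates are uniform in `α` and so survive the supremum (`abs_ciSup_sub_ciSup_le`). -/

theorem affineMap_apply_sum {V : Type*} [AddCommGroup V] [Module ℝ V] (l : V →ᵃ[ℝ] ℝ)
    {s : Finset V} {w : V → ℝ} (hw : ∑ p ∈ s, w p = 1) :
    l (∑ p ∈ s, w p • p) = ∑ p ∈ s, w p * l p := by
  have h : ∀ z, l z = l.linear z + l 0 := fun z => congrFun l.decomp z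
  rw [h, map_sum]
  have h' : ∀ p ∈ s, w p * l p = l.linear (w p • p) + w p * l 0 := fun p _ => by
    rw [h p, map_smul, smul_eq_mul, mul_add]
  rw [Finset.sum_congr rfl h', Finset.sum_add_distrib, ← Finset.sum_mul, hw, one_mul]

theorem IsMesh.exists_element (hK : IsMesh Ω ΓD ΓR Γt K) {x : E d} (hx : x ∈ K.space) :
    ∃ s ∈ K.faces, s.card = d + 1 ∧ x ∈ convexHull ℝ (s : Set (E d)) := by
  obtain ⟨s, hs, hxs⟩ := Geometry.SimplicialComplex.mem_space_iff.1 hx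
  obtain ⟨s', hs', hss', hc⟩ := hK.pure s hs
  exact ⟨s', hs', hc, convexHull_mono (Finset.coe_subset.2 hss') hxs⟩

theorem IsMesh.finite_elements (hK : IsMesh Ω ΓD ΓR Γt K) : (elements K).Finite := by
  refine (hK.finite.image fun s : Finset (E d) => convexHull ℝ (s : Set (E d))).subset ?_
  rintro _ ⟨s, hs, -, rfl⟩
  exact ⟨s, hs, rfl⟩

theorem isCompact_of_mem_elements {k : Set (E d)} (hk : k ∈ elements K) : IsCompact k := by
  obtain ⟨s, -, -, rfl⟩ := hk
  exact s.finite_toSet.isCompact_convexHull ℝ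

theorem convex_of_mem_elements {k : Set (E d)} (hk : k ∈ elements K) : Convex ℝ k := by
  obtain ⟨s, -, -, rfl⟩ := hk
  exact convex_convexHull ℝ _

theorem subset_space_of_mem_elements {k : Set (E d)} (hk : k ∈ elements K) : k ⊆ K.space := by
  obtain ⟨s, hs, -, rfl⟩ := hk
  exact Geometry.SimplicialComplex.convexHull_subset_space hs

theorem interior_nonempty_of_mem_elements {k : Set (E d)} (hk : k ∈ elements K) :
    (interior k).Nonempty := by
  obtain ⟨s, hs, hc, rfl⟩ := hk
  rw [interior_convexHull_nonempty_iff_affineSpan_eq_top]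
  have h := K.indep hs
  have := (h.affineSpan_eq_top_iff_card_eq_finrank_add_one).2 (by simp [hc])
  simpa using this

theorem IsMesh.interior_element_subset (hK : IsMesh Ω ΓD ΓR Γt K)
    (hΩ : interior (closure Ω) = Ω) {k : Set (E d)} (hk : k ∈ elements K) : interior k ⊆ Ω := by
  rw [← hΩ, ← hK.space_eq]
  exact interior_mono (subset_space_of_mem_elements hk)

theorem IsMesh.diam_le_meshSize (hK : IsMesh Ω ΓD ΓR Γt K) {k : Set (E d)}
    (hk : k ∈ elements K) : Metric.diam k ≤ meshSize K :=
  le_csSup (hK.finite_elements.image _).bddAbove ⟨k, hk, rfl⟩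

theorem IsMesh.dist_le_meshSize (hK : IsMesh Ω ΓD ΓR Γt K) {k : Set (E d)}
    (hk : k ∈ elements K) {x z : E d} (hx : x ∈ k) (hz : z ∈ k) : dist x z ≤ meshSize K :=
  (Metric.dist_le_diam_of_mem (isCompact_of_mem_elements hk).isBounded hx hz).trans
    (hK.diam_le_meshSize hk)

/-- Frontiers of convex sets are Lebesgue null and there are finitely many elements. Off this null
set a finite element function is locally affine. -/
theorem IsMesh.ae_mem_interior_element (hK : IsMesh Ω ΓD ΓR Γt K) :
    ∀ᵐ x ∂(volume.restrict (closure Ω)), ∃ k ∈ elements K, x ∈ interior k := by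
  have h0 : volume (⋃ k ∈ elements K, frontier k) = 0 := by
    rw [measure_biUnion_null_iff hK.finite_elements.countable]
    exact fun k hk => (convex_of_mem_elements hk).addHaar_frontier volume
  rw [ae_restrict_iff' isClosed_closure.measurableSet]
  filter_upwards [measure_eq_zero_iff_ae_notMem.1 h0] with x hx hxΩ
  rw [← hK.space_eq] at hxΩ
  obtain ⟨s, hs, hc, hxs⟩ := hK.exists_element hxΩ
  have hk : convexHull ℝ (s : Set (E d)) ∈ elements K := ⟨s, hs, hc, rfl⟩
  refine ⟨_, hk, ?_⟩
  by_contra hxi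
  exact hx (mem_biUnion hk ⟨subset_closure hxs, hxi⟩)

/-- The gradient of an affine function. -/
noncomputable def affineGradient (l : E d →ᵃ[ℝ] ℝ) : E d :=
  (InnerProductSpace.toDual ℝ (E d)).symm (LinearMap.toContinuousLinearMap l.linear)

theorem inner_affineGradient (l : E d →ᵃ[ℝ] ℝ) (b : E d) :
    inner ℝ (affineGradient l) b = l.linear b := by
  simp [affineGradient]

theorem affineMap_add (l : E d →ᵃ[ℝ] ℝ) (y v : E d) :
    l (y + v) = l y + inner ℝ (affineGradient l) v := by
  rw [inner_affineGradient, add_comm y v, ← vadd_eq_add, l.map_vadd]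
  simp [add_comm]

theorem hasGradientAt_affineMap (l : E d →ᵃ[ℝ] ℝ) (x : E d) :
    HasGradientAt l (affineGradient l) x := by
  rw [hasGradientAt_iff_hasFDerivAt]
  have h : ⇑l = fun z => LinearMap.toContinuousLinearMap l.linear z + l 0 := by
    ext z
    exact congrFun l.decomp z
  rw [h]
  simpa [affineGradient] using (LinearMap.toContinuousLinearMap l.linear).hasFDerivAt.add_const (l 0)

theorem hasGradientAt_of_eqOn_affineMap {w : E d → ℝ} {l : E d →ᵃ[ℝ] ℝ} {k : Set (E d)}
    (h : EqOn w l k) {x : E d} (hx : x ∈ interior k) : HasGradientAt w (affineGradient l) x :=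
  (hasGradientAt_affineMap l x).congr_of_eventuallyEq
    (by filter_upwards [mem_interior_iff_mem_nhds.1 hx] with z hz using h hz)

theorem IsMesh.ae_differentiableAt (hK : IsMesh Ω ΓD ΓR Γt K) {w : E d → ℝ} (hw : w ∈ P1 K) :
    ∀ᵐ x ∂(volume.restrict (closure Ω)), DifferentiableAt ℝ w x := by
  filter_upwards [hK.ae_mem_interior_element] with x ⟨k, hk, hx⟩
  obtain ⟨l, hl⟩ := hw.2.1 k hk
  exact (hasGradientAt_of_eqOn_affineMap hl hx).differentiableAt

/-- By pigeonhole one of the finitely many sets contains points of the ray at arbitrarily small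
parameters. Closedness adds the starting point, and convexity the whole segment in between. -/
theorem exists_mem_forall_Icc_mem {ι : Set (Set (E d))} (hι : ι.Finite)
    (hc : ∀ k ∈ ι, IsClosed k ∧ Convex ℝ k) {y b : E d} {Λ : ℝ} (hΛ : 0 < Λ)
    (h : ∀ r ∈ Icc 0 Λ, y + r • b ∈ ⋃₀ ι) :
    ∃ k ∈ ι, ∃ r : ℝ, 0 < r ∧ ∀ ρ ∈ Icc 0 r, y + ρ • b ∈ k := by
  have hcl : ∀ k ∈ ι, IsClosed {r : ℝ | y + r • b ∈ k} := fun k hk =>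
    (hc k hk).1.preimage (by fun_prop)
  have hfr : ∃ k ∈ ι, ∃ᶠ r in 𝓝[>] (0 : ℝ), y + r • b ∈ k := by
    by_contra hcon
    push Not at hcon
    have h1 : ∀ᶠ r in 𝓝[>] (0 : ℝ), ∀ k ∈ ι, y + r • b ∉ k :=
      (eventually_all_finite hι).2 fun k hk => hcon k hk
    have h2 : ∀ᶠ r in 𝓝[>] (0 : ℝ), r ∈ Ioc 0 Λ := Ioc_mem_nhdsGT hΛ
    obtain ⟨r, hr1, hr2⟩ := (h1.and h2).exists
    obtain ⟨k, hk, hrk⟩ := h r ⟨hr2.1.le, hr2.2⟩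
    exact hr1 k hk hrk
  obtain ⟨k, hk, hfr⟩ := hfr
  have hy : y ∈ k := by
    have : (0 : ℝ) ∈ closure {r : ℝ | y + r • b ∈ k} :=
      mem_closure_iff_frequently.2 (hfr.filter_mono nhdsWithin_le_nhds)
    rw [(hcl k hk).closure_eq] at this
    simpa using this
  obtain ⟨r, hrk, hr⟩ := (hfr.and_eventually self_mem_nhdsWithin).exists
  refine ⟨k, hk, r, hr, fun ρ hρ => ?_⟩
  have hr' : 0 < r := hr
  have hz := (hc k hk).2.add_smul_sub_mem hy hrk (t := ρ / r)
    ⟨div_nonneg hρ.1 hr'.le, by rw [div_le_one hr']; exact hρ.2⟩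
  rwa [add_sub_cancel_left, smul_smul, div_mul_cancel₀ _ hr'.ne'] at hz

theorem IsMesh.space_eq_sUnion (hK : IsMesh Ω ΓD ΓR Γt K) : K.space = ⋃₀ elements K := by
  refine Subset.antisymm (fun x hx => ?_) (sUnion_subset fun k hk => subset_space_of_mem_elements hk)
  obtain ⟨s, hs, hc, hxs⟩ := hK.exists_element hx
  exact ⟨_, ⟨s, hs, hc, rfl⟩, hxs⟩

/-- The Dini derivative of a finite element function in a direction of the tangent cone is given by
the gradient of the function on a single element. -/
theorem IsMesh.exists_element_dini (hK : IsMesh Ω ΓD ΓR Γt K) {y b : E d}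
    (hb : b ∈ tangentCone Ω y) :
    ∃ k ∈ elements K, y ∈ k ∧ ∀ (w : E d → ℝ) (l : E d →ᵃ[ℝ] ℝ), EqOn w l k →
      dini b w y = -inner ℝ (affineGradient l) b := by
  obtain ⟨Λ, hΛ, h⟩ := hb
  rw [← hK.space_eq, hK.space_eq_sUnion] at h
  obtain ⟨k, hk, r, hr, hkr⟩ := exists_mem_forall_Icc_mem hK.finite_elements
    (fun k hk => ⟨(isCompact_of_mem_elements hk).isClosed, convex_of_mem_elements hk⟩) hΛ h
  have hy : y ∈ k := by simpa using hkr 0 ⟨le_rfl, hr.le⟩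
  refine ⟨k, hk, hy, fun w l hl => ?_⟩
  -- The quotient is constant for small `ρ`, so the real-valued `liminf` is simply this constant.
  have hev : (fun ρ : ℝ => (w y - w (y + ρ • b)) / ρ) =ᶠ[𝓝[>] 0]
      fun _ => -inner ℝ (affineGradient l) b := by
    filter_upwards [Ioc_mem_nhdsGT hr] with ρ hρ
    rw [hl hy, hl (hkr ρ ⟨hρ.1.le, hρ.2⟩), affineMap_add, inner_smul_right]
    field_simp [hρ.1.ne']
    ring
  rw [dini, liminf_congr hev]
  exact liminf_const _

/-! ### Hat functions -/

variable {φ : E d → E d → ℝ} {y : E d}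

/-- On an element the hat function is affine with nodal values 0 and 1, so it is the barycentric
coordinate belonging to `y`. -/
theorem IsHatFamily.apply_sum (hφ : IsHatFamily K φ) (hy : y ∈ K.vertices) {s : Finset (E d)}
    (hs : s ∈ K.faces) (hc : s.card = d + 1) {w : E d → ℝ} (hw0 : ∀ p ∈ s, 0 ≤ w p)
    (hw : ∑ p ∈ s, w p = 1) [Decidable (y ∈ s)] :
    φ y (∑ p ∈ s, w p • p) = if y ∈ s then w y else 0 := by
  classical
  obtain ⟨hP, h1, h0⟩ := hφ y hy
  obtain ⟨l, hl⟩ := hP.2.1 _ ⟨s, hs, hc, rfl⟩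
  have hmem : ∑ p ∈ s, w p • p ∈ convexHull ℝ (s : Set (E d)) :=
    Finset.mem_convexHull'.2 ⟨w, hw0, hw, rfl⟩
  rw [hl hmem, affineMap_apply_sum l hw]
  have hv : ∀ p ∈ s, l p = if p = y then 1 else 0 := by
    intro p hp
    have hpv : p ∈ K.vertices :=
      K.down_closed hs (Finset.singleton_subset_iff.2 hp) (Finset.singleton_nonempty _)
    rw [← hl (subset_convexHull ℝ _ hp)]
    split_ifs with hpy
    · rw [hpy, h1]
    · exact h0 p hpv hpy
  rw [Finset.sum_congr rfl fun p hp => by rw [hv p hp]]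
  simp

theorem IsMesh.hat_nonneg (hK : IsMesh Ω ΓD ΓR Γt K) (hφ : IsHatFamily K φ)
    (hy : y ∈ K.vertices) (x : E d) : 0 ≤ φ y x := by
  classical
  by_cases hx : x ∈ K.space
  · obtain ⟨s, hs, hc, hxs⟩ := hK.exists_element hx
    obtain ⟨w, hw0, hw, rfl⟩ := Finset.mem_convexHull'.1 hxs
    rw [hφ.apply_sum hy hs hc hw0 hw]
    split_ifs with h
    exacts [hw0 _ h, le_rfl]
  · exact ((hφ y hy).1.2.2 x hx).ge

/-- A point where the hat function at `y` does not vanish shares an element with `y`. -/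
theorem IsMesh.exists_element_of_hat_ne_zero (hK : IsMesh Ω ΓD ΓR Γt K) (hφ : IsHatFamily K φ)
    (hy : y ∈ K.vertices) {x : E d} (hx : φ y x ≠ 0) :
    ∃ k ∈ elements K, y ∈ k ∧ x ∈ k := by
  classical
  have hxK : x ∈ K.space := by
    by_contra h
    exact hx ((hφ y hy).1.2.2 x h)
  obtain ⟨s, hs, hc, hxs⟩ := hK.exists_element hxK
  refine ⟨_, ⟨s, hs, hc, rfl⟩, ?_, hxs⟩
  obtain ⟨w, hw0, hw, rfl⟩ := Finset.mem_convexHull'.1 hxs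
  rw [hφ.apply_sum hy hs hc hw0 hw] at hx
  have : y ∈ s := by
    by_contra h
    simp [h] at hx
  exact subset_convexHull ℝ _ this

/-- Undo a contraction towards the vertex `y`: divide the weights of the other vertices by `ε` and
let `y` take the rest. The bound `hwy` says exactly that the new weight of `y` is nonnegative. -/
theorem add_mem_convexHull_of_add_smul {s : Finset (E d)} (hy : y ∈ s) {v : E d} {ε : ℝ} (hε : 0 < ε)
    {w : E d → ℝ} (hw0 : ∀ p ∈ s, 0 ≤ w p) (hw : ∑ p ∈ s, w p = 1)
    (hv : ∑ p ∈ s, w p • p = y + ε • v) (hwy : 1 - w y ≤ ε) :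
    y + v ∈ convexHull ℝ (s : Set (E d)) := by
  classical
  refine Finset.mem_convexHull'.2 ⟨fun p => if p = y then 1 - (1 - w y) / ε else w p / ε, ?_, ?_, ?_⟩
  · intro p hp
    dsimp only
    split_ifs
    · rw [sub_nonneg, div_le_one hε]
      exact hwy
    · exact div_nonneg (hw0 p hp) hε.le
  · rw [← Finset.add_sum_erase s _ hy] at hw ⊢
    rw [Finset.sum_congr rfl (g := fun p => w p / ε)
      fun p hp => by rw [if_neg (Finset.ne_of_mem_erase hp)], ← Finset.sum_div, if_pos rfl]
    have : ∑ p ∈ s.erase y, w p = 1 - w y := by linarith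
    rw [this]
    ring
  · have h1 : ∑ p ∈ s.erase y, w p • p = y + ε • v - w y • y := by
      rw [← hv, ← Finset.add_sum_erase s _ hy]
      abel
    rw [← Finset.add_sum_erase s _ hy]
    rw [Finset.sum_congr rfl (g := fun p => ε⁻¹ • (w p • p))
      fun p hp => by simp only [if_neg (Finset.ne_of_mem_erase hp), smul_smul, div_eq_inv_mul],
      ← Finset.smul_sum, h1]
    simp only [if_true]
    rw [smul_sub, smul_add, smul_smul, smul_smul, inv_mul_cancel₀ hε.ne', one_smul]
    have : (1 - (1 - w y) / ε) • y = y - ε⁻¹ • y + (ε⁻¹ * w y) • y := by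
      module
    rw [this]
    abel

/-- Hat functions of interior nodes vanish off the interior of the meshed set. -/
theorem IsMesh.mem_interior_of_hat_ne_zero (hK : IsMesh Ω ΓD ΓR Γt K) (hφ : IsHatFamily K φ)
    (hy : y ∈ K.vertices) (hyi : y ∈ interior K.space) {x : E d} (hx : φ y x ≠ 0) :
    x ∈ interior K.space := by
  classical
  have hpos : 0 < φ y x := lt_of_le_of_ne (hK.hat_nonneg hφ hy x) hx.symm
  obtain ⟨k, hk, hyk, hxk⟩ := hK.exists_element_of_hat_ne_zero hφ hy hx
  obtain ⟨hP, h1, -⟩ := hφ y hy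
  -- Near `y` only elements containing `y` occur; it is there that the hypothesis on `y` as an
  -- interior point enters.
  have hU : ∀ᶠ z in 𝓝 y, z ∈ interior K.space ∧ ∀ k ∈ elements K, y ∉ k → z ∉ k := by
    refine (isOpen_interior.eventually_mem hyi).and ((eventually_all_finite hK.finite_elements).2 ?_)
    intro k hk
    by_cases h : y ∈ k
    · exact Eventually.of_forall fun z hz => absurd h hz
    · filter_upwards [(isCompact_of_mem_elements hk).isClosed.isOpen_compl.mem_nhds h] with z hz _
      exact hz
  have hcont : Tendsto (fun ε : ℝ => y + ε • (x - y)) (𝓝[>] 0) (𝓝 y) := by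
    have : Continuous fun ε : ℝ => y + ε • (x - y) := by fun_prop
    simpa using (this.tendsto 0).mono_left nhdsWithin_le_nhds
  obtain ⟨ε, hεU, hε0, hε1⟩ :=
    ((hcont.eventually hU.eventually_nhds).and (Ioc_mem_nhdsGT (zero_lt_one' ℝ))).exists
  have hval : φ y (y + ε • (x - y)) = 1 + ε * (φ y x - 1) := by
    obtain ⟨l, hl⟩ := hP.2.1 k hk
    have hmem : y + ε • (x - y) ∈ k :=
      (convex_of_mem_elements hk).add_smul_sub_mem hyk hxk ⟨hε0.le, hε1⟩
    have hx' := affineMap_add l y (x - y)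
    rw [add_sub_cancel, ← hl hxk, ← hl hyk, h1] at hx'
    rw [hl hmem, affineMap_add, inner_smul_right, ← hl hyk, h1, hx']
    ring
  have hφc : ContinuousAt (φ y) (y + ε • (x - y)) :=
    (hP.1.mono interior_subset).continuousAt (isOpen_interior.mem_nhds hεU.self_of_nhds.1)
  have hgt : ∀ᶠ z in 𝓝 (y + ε • (x - y)), 1 - ε < φ y z :=
    hφc.eventually (lt_mem_nhds (by rw [hval]; nlinarith))
  have hcont' : Tendsto (fun x' => y + ε • (x' - y)) (𝓝 x) (𝓝 (y + ε • (x - y))) := by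
    have : Continuous fun x' => y + ε • (x' - y) := by fun_prop
    exact this.tendsto x
  rw [mem_interior_iff_mem_nhds]
  -- Contract a neighbour `x'` of `x` towards `y` by the factor `ε`. The image lies in an element
  -- with vertex `y` and has weight above `1 - ε` there, because the hat function is positive at
  -- `x`; stretching back keeps `x'` in the same element.
  filter_upwards [hcont'.eventually (hεU.and hgt)] with x' ⟨⟨hx'i, hx'k⟩, hx'φ⟩
  obtain ⟨s, hs, hc, hxs⟩ := hK.exists_element (interior_subset hx'i)
  have hys : y ∈ s := by
    rw [← K.vertex_mem_convexHull_iff hy hs]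
    by_contra h
    exact hx'k _ ⟨s, hs, hc, rfl⟩ h hxs
  obtain ⟨w, hw0, hw, hwx⟩ := Finset.mem_convexHull'.1 hxs
  rw [← hwx, hφ.apply_sum hy hs hc hw0 hw, if_pos hys] at hx'φ
  have := add_mem_convexHull_of_add_smul hys hε0 hw0 hw hwx (by linarith)
  rw [add_sub_cancel] at this
  exact Geometry.SimplicialComplex.convexHull_subset_space hs this

end Mesh

/-! ### Lipschitz continuity, integration by parts, smooth approximation -/

section Analysis

/-- Follow the segment from `a` to `b`: the parameters satisfying the estimate form a closed set,
and from each of them one can go further, since some piece contains the current point and points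
just ahead of it. The pieces need not be convex, which admits the complement of the domain as a
piece. -/
theorem lipschitzWith_of_finite_closed_cover {V : Type*} [NormedAddCommGroup V] [NormedSpace ℝ V]
    {f : V → ℝ} (hf : Continuous f) {ι : Set (Set V)} (hι : ι.Finite)
    (hcl : ∀ k ∈ ι, IsClosed k) (hcov : ∀ x, ∃ k ∈ ι, x ∈ k) {L : ℝ≥0}
    (hL : ∀ k ∈ ι, LipschitzOnWith L f k) : LipschitzWith L f := by
  refine LipschitzWith.of_dist_le_mul fun b a => ?_
  set γ : ℝ → V := fun r => a + r • (b - a) with hγ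
  have hγc : Continuous γ := by fun_prop
  have hγd : ∀ r r', dist (γ r) (γ r') = |r - r'| * dist b a := by
    intro r r'
    rw [dist_eq_norm, dist_eq_norm, ← Real.norm_eq_abs, ← norm_smul]
    congr 1
    simp only [hγ]
    module
  set S : Set ℝ := {r | dist (f (γ r)) (f a) ≤ L * (r * dist b a)} with hS
  have hScl : IsClosed (S ∩ Icc 0 1) := by
    refine IsClosed.inter (isClosed_le ?_ ?_) isClosed_Icc
    · exact (hf.comp hγc).dist continuous_const
    · fun_prop
  have key : Icc (0 : ℝ) 1 ⊆ S := by
    refine hScl.Icc_subset_of_forall_exists_gt (by simp [hS, hγ]) ?_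
    rintro r ⟨hrS, hr⟩ r' hr'
    have hfr : ∃ k ∈ ι, ∃ᶠ ρ in 𝓝[>] r, γ ρ ∈ k := by
      by_contra hcon
      push Not at hcon
      obtain ⟨ρ, hρ⟩ := ((eventually_all_finite hι).2 fun k hk => hcon k hk).exists
      obtain ⟨k, hk, hρk⟩ := hcov (γ ρ)
      exact hρ k hk hρk
    obtain ⟨k, hk, hfr⟩ := hfr
    have hrk : γ r ∈ k := by
      have : r ∈ closure (γ ⁻¹' k) :=
        mem_closure_iff_frequently.2 (hfr.filter_mono nhdsWithin_le_nhds)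
      rwa [((hcl k hk).preimage hγc).closure_eq] at this
    obtain ⟨ρ, hρk, hρ⟩ := (hfr.and_eventually (Ioc_mem_nhdsGT hr')).exists
    refine ⟨ρ, ?_, hρ⟩
    have h1 := (hL k hk).dist_le_mul _ hρk _ hrk
    rw [hγd, abs_of_pos (sub_pos.2 hρ.1)] at h1
    have h2 : dist (f (γ r)) (f a) ≤ L * (r * dist b a) := hrS
    calc dist (f (γ ρ)) (f a) ≤ dist (f (γ ρ)) (f (γ r)) + dist (f (γ r)) (f a) :=
          dist_triangle _ _ _
      _ ≤ L * ((ρ - r) * dist b a) + L * (r * dist b a) := add_le_add h1 h2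
      _ = L * (ρ * dist b a) := by ring
  have := key (right_mem_Icc.2 zero_le_one)
  simpa [hS, hγ] using this

theorem exists_compactSupport_eventuallyEq {d : ℕ} {n : ℕ∞} {w : E d → ℝ} (hw : ContDiff ℝ n w)
    (R : ℝ) : ∃ w' : E d → ℝ, ContDiff ℝ n w' ∧ HasCompactSupport w' ∧
      ∀ x ∈ Metric.ball (0 : E d) R, w' =ᶠ[𝓝 x] w := by
  -- The maximum keeps the inner radius positive when `R ≤ 0`.
  let χ : ContDiffBump (0 : E d) := ⟨max R 1, max R 1 + 1, by positivity, by linarith⟩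
  refine ⟨fun x => χ x * w x, χ.contDiff.mul hw, χ.hasCompactSupport.mul_right, fun x hx => ?_⟩
  filter_upwards [χ.eventuallyEq_one_of_mem_ball
    (Metric.ball_subset_ball (le_max_left R 1) hx)] with z hz
  simp [hz]

/-- Mollification: compact support makes `u` and its derivative uniformly continuous, and the
derivative of the convolution falls on `u`, so one kernel radius controls both errors. -/
theorem exists_contDiff_approx_of_hasCompactSupport {d : ℕ} {u : E d → ℝ} (hu : ContDiff ℝ 1 u)
    (hc : HasCompactSupport u) {ε : ℝ} (hε : 0 < ε) :
    ∃ v : E d → ℝ, ContDiff ℝ ((⊤ : ℕ∞) : WithTop ℕ∞) v ∧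
      ∀ x, |v x - u x| ≤ ε ∧ ‖fderiv ℝ v x - fderiv ℝ u x‖ ≤ ε := by
  have hfc : Continuous (fderiv ℝ u) := hu.continuous_fderiv one_ne_zero
  have huc : UniformContinuous u := hc.uniformContinuous_of_continuous hu.continuous
  have hfuc : UniformContinuous (fderiv ℝ u) := (hc.fderiv ℝ).uniformContinuous_of_continuous hfc
  obtain ⟨δ₁, hδ₁, h₁⟩ := Metric.uniformContinuous_iff.1 huc ε hε
  obtain ⟨δ₂, hδ₂, h₂⟩ := Metric.uniformContinuous_iff.1 hfuc ε hε
  set δ := min δ₁ δ₂ with hδ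
  have hδ0 : 0 < δ := lt_min hδ₁ hδ₂
  let χ : ContDiffBump (0 : E d) := ⟨δ / 2, δ, by positivity, by linarith⟩
  have hli : LocallyIntegrable (χ.normed volume) (volume : Measure (E d)) :=
    χ.continuous_normed.locallyIntegrable
  set v : E d → ℝ := convolution (χ.normed volume) u (ContinuousLinearMap.lsmul ℝ ℝ) volume with hv
  refine ⟨v, χ.hasCompactSupport_normed.contDiff_convolution_left _ χ.contDiff_normed
    hu.continuous.locallyIntegrable, fun x => ⟨?_, ?_⟩⟩
  · have := χ.dist_normed_convolution_le (μ := volume) (g := u) (x₀ := x) (ε := ε)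
      hu.continuous.aestronglyMeasurable
      fun z hz => (h₁ (lt_of_lt_of_le (Metric.mem_ball.1 hz) (min_le_left _ _))).le
    rwa [Real.dist_eq] at this
  · have hd := (hc.hasFDerivAt_convolution_right (ContinuousLinearMap.lsmul ℝ ℝ) hli hu x).fderiv
    rw [← hv] at hd
    have := χ.dist_normed_convolution_le (μ := volume) (g := fderiv ℝ u) (x₀ := x) (ε := ε)
      hfc.aestronglyMeasurable
      fun z hz => (h₂ (lt_of_lt_of_le (Metric.mem_ball.1 hz) (min_le_right _ _))).le
    rw [dist_eq_norm] at this
    rw [hd]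
    exact this

/-- A `C¹` function is approximated in `C¹` on bounded sets by smooth functions. -/
theorem exists_contDiff_approx {d : ℕ} {u : E d → ℝ} (hu : ContDiff ℝ 1 u) {S : Set (E d)}
    (hS : Bornology.IsBounded S) {ε : ℝ} (hε : 0 < ε) :
    ∃ v : E d → ℝ, ContDiff ℝ ((⊤ : ℕ∞) : WithTop ℕ∞) v ∧
      ∀ x ∈ S, |v x - u x| ≤ ε ∧ ‖gradient v x - gradient u x‖ ≤ ε := by
  obtain ⟨R, hR⟩ := hS.subset_ball 0
  obtain ⟨u', hu', hc, he⟩ := exists_compactSupport_eventuallyEq (n := 1) hu R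
  obtain ⟨v, hv, hvu⟩ := exists_contDiff_approx_of_hasCompactSupport hu' hc hε
  refine ⟨v, hv, fun x hx => ?_⟩
  have := hvu x
  rw [(he x (hR hx)).eq_of_nhds, (he x (hR hx)).fderiv_eq] at this
  refine ⟨this.1, ?_⟩
  rw [gradient, gradient, ← map_sub, LinearIsometryEquiv.norm_map]
  exact this.2

theorem inner_gradient {d : ℕ} (w : E d → ℝ) (x v : E d) :
    inner ℝ (gradient w x) v = fderiv ℝ w x v := by
  simp [gradient]

theorem laplacian_eq_sum {d : ℕ} (w : E d → ℝ) (x : E d) :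
    Laplacian.laplacian w x = ∑ j, fderiv ℝ (fderiv ℝ w) x
      (EuclideanSpace.basisFun (Fin d) ℝ j) (EuclideanSpace.basisFun (Fin d) ℝ j) := by
  rw [InnerProductSpace.laplacian_eq_iteratedFDeriv_orthonormalBasis w
    (EuclideanSpace.basisFun (Fin d) ℝ)]
  simp [iteratedFDeriv_two_apply]

/-- By Rademacher's theorem the gradient of `η` consists almost everywhere of line derivatives, for
which integration by parts between Lipschitz functions holds coordinate by coordinate. -/
theorem integral_inner_gradient_of_hasCompactSupport {d : ℕ} {w η : E d → ℝ} (hw : ContDiff ℝ 2 w)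
    (hwc : HasCompactSupport w) {C : ℝ≥0} (hη : LipschitzWith C η) :
    ∫ x, inner ℝ (gradient w x) (gradient η x) = -∫ x, Laplacian.laplacian w x * η x := by
  set e := EuclideanSpace.basisFun (Fin d) ℝ with he
  have hfd : ContDiff ℝ 1 (fderiv ℝ w) := hw.fderiv_right (by norm_num)
  have hg : ∀ j, ContDiff ℝ 1 fun x => fderiv ℝ w x (e j) := fun j => hfd.clm_apply contDiff_const
  have hgc : ∀ j, HasCompactSupport fun x => fderiv ℝ w x (e j) := fun j => hwc.fderiv_apply ℝ (e j)
  -- The integration by parts formula transfers the derivative in the opposite direction `-e j`,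
  -- which carries the minus sign.
  have hgd : ∀ j x, lineDeriv ℝ (fun x => fderiv ℝ w x (e j)) x (-e j)
      = -fderiv ℝ (fderiv ℝ w) x (e j) (e j) := by
    intro j x
    rw [((hg j).differentiable one_ne_zero x).lineDeriv_eq_fderiv, map_neg,
      fderiv_clm_apply (hfd.differentiable one_ne_zero x) (differentiableAt_const _)]
    simp
  have hIl : ∀ j, Integrable fun x => lineDeriv ℝ η x (e j) * fderiv ℝ w x (e j) := fun j =>
    ((hg j).continuous.integrable_of_hasCompactSupport (hgc j)).bdd_mul
      (measurable_lineDeriv hη.continuous).aestronglyMeasurable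
      (Eventually.of_forall fun x => norm_lineDeriv_le_of_lipschitz ℝ hη)
  have hIr : ∀ j, Integrable fun x => fderiv ℝ (fderiv ℝ w) x (e j) (e j) * η x := by
    intro j
    have hc2 : Continuous fun x => fderiv ℝ (fderiv ℝ w) x (e j) (e j) :=
      ((hfd.continuous_fderiv one_ne_zero).clm_apply continuous_const).clm_apply continuous_const
    refine (hc2.mul hη.continuous).integrable_of_hasCompactSupport (HasCompactSupport.mul_right ?_)
    exact ((hwc.fderiv ℝ).fderiv ℝ).comp_left (g := fun T => T (e j) (e j)) (by simp)
  calc ∫ x, inner ℝ (gradient w x) (gradient η x)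
      = ∫ x, ∑ j, lineDeriv ℝ η x (e j) * fderiv ℝ w x (e j) := by
        refine integral_congr_ae ?_
        filter_upwards [hη.ae_differentiableAt] with x hx
        rw [← e.sum_inner_mul_inner]
        refine Finset.sum_congr rfl fun j _ => ?_
        rw [hx.lineDeriv_eq_fderiv, inner_gradient, real_inner_comm, inner_gradient, mul_comm]
    _ = ∑ j, ∫ x, lineDeriv ℝ η x (e j) * fderiv ℝ w x (e j) :=
        integral_finsetSum _ fun j _ => hIl j
    _ = ∑ j, -∫ x, fderiv ℝ (fderiv ℝ w) x (e j) (e j) * η x := by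
        refine Finset.sum_congr rfl fun j _ => ?_
        obtain ⟨C', hC'⟩ := (hg j).lipschitzWith_of_hasCompactSupport (hgc j) one_ne_zero
        rw [hη.integral_lineDeriv_mul_eq hC' (hgc j), ← integral_neg]
        simp_rw [hgd, neg_mul]
    _ = -∫ x, Laplacian.laplacian w x * η x := by
        rw [Finset.sum_neg_distrib, ← integral_finsetSum _ fun j _ => hIr j]
        simp_rw [laplacian_eq_sum, Finset.sum_mul, he]

/-- Here `η` has the compact support. Cutting `w` off outside a ball containing it changes neither
integral, as both integrands vanish off `tsupport η`. -/
theorem integral_inner_gradient {d : ℕ} {w η : E d → ℝ} (hw : ContDiff ℝ 2 w)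
    {C : ℝ≥0} (hη : LipschitzWith C η) (hηc : HasCompactSupport η) :
    ∫ x, inner ℝ (gradient w x) (gradient η x) = -∫ x, Laplacian.laplacian w x * η x := by
  obtain ⟨R, hR⟩ := hηc.isCompact.isBounded.subset_ball 0
  obtain ⟨w', hw', hwc, he⟩ := exists_compactSupport_eventuallyEq (n := 2) hw R
  have h := integral_inner_gradient_of_hasCompactSupport hw' hwc hη
  have hgr : ∀ x ∉ tsupport η, gradient η x = 0 := by
    intro x hx
    have : η =ᶠ[𝓝 x] fun _ => 0 := notMem_tsupport_iff_eventuallyEq.1 hx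
    rw [gradient, this.fderiv_eq]
    simp
  convert h using 1
  · refine integral_congr_ae (Eventually.of_forall fun x => ?_)
    by_cases hx : x ∈ tsupport η
    · simp only [gradient, (he x (hR hx)).fderiv_eq]
    · simp [hgr x hx]
  · congr 1
    refine integral_congr_ae (Eventually.of_forall fun x => ?_)
    by_cases hx : x ∈ tsupport η
    · simp only [InnerProductSpace.laplacian_congr_nhds (he x (hR hx)) |>.eq_of_nhds]
    · simp [image_eq_zero_of_notMem_tsupport hx]

end Analysis

/-! ### Global continuity and Lipschitz continuity of interior hat functions -/

section Hat

variable {d : ℕ} {K : Geometry.SimplicialComplex ℝ (E d)} {Ω ΓD ΓR Γt : Set (E d)}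
  {φ : E d → E d → ℝ} {y : E d}

/-- The zero extension is continuous on two closed sets that cover the space: the meshed set and the
complement of its interior, where it vanishes. -/
theorem IsMesh.continuous_hat (hK : IsMesh Ω ΓD ΓR Γt K) (hφ : IsHatFamily K φ)
    (hy : y ∈ K.vertices) (hyi : y ∈ interior K.space) : Continuous (φ y) := by
  have h0 : ContinuousOn (φ y) (interior K.space)ᶜ := by
    refine (continuousOn_const (c := (0 : ℝ))).congr fun x hx => ?_
    by_contra h
    exact hx (hK.mem_interior_of_hat_ne_zero hφ hy hyi h)
  have hcl : IsClosed K.space := by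
    rw [hK.space_eq]
    exact isClosed_closure
  have := (hφ y hy).1.1.union_of_isClosed h0 hcl isOpen_interior.isClosed_compl
  rw [← continuousOn_univ]
  refine this.mono fun x _ => ?_
  by_cases hx : x ∈ interior K.space
  exacts [Or.inl (interior_subset hx), Or.inr hx]

theorem IsMesh.exists_lipschitzWith_hat (hK : IsMesh Ω ΓD ΓR Γt K) (hφ : IsHatFamily K φ)
    (hy : y ∈ K.vertices) (hyi : y ∈ interior K.space) : ∃ C, LipschitzWith C (φ y) := by
  have hex : ∀ k ∈ elements K, ∃ C, LipschitzOnWith C (φ y) k := by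
    intro k hk
    obtain ⟨l, hl⟩ := (hφ y hy).1.2.1 k hk
    refine ⟨‖affineGradient l‖₊, LipschitzOnWith.of_dist_le_mul fun a ha b hb => ?_⟩
    have := affineMap_add l b (a - b)
    rw [add_sub_cancel] at this
    rw [hl ha, hl hb, this, Real.dist_eq, add_sub_cancel_left, dist_eq_norm]
    exact abs_real_inner_le_norm _ _
  choose! C hC using hex
  obtain ⟨B, hB⟩ := (hK.finite_elements.image C).bddAbove
  refine ⟨B, lipschitzWith_of_finite_closed_cover (hK.continuous_hat hφ hy hyi)
    (hK.finite_elements.insert (interior K.space)ᶜ) ?_ ?_ ?_⟩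
  · rintro k (rfl | hk)
    exacts [isOpen_interior.isClosed_compl, (isCompact_of_mem_elements hk).isClosed]
  · intro x
    by_cases hx : x ∈ interior K.space
    · have := interior_subset hx
      rw [hK.space_eq_sUnion] at this
      obtain ⟨k, hk, hxk⟩ := this
      exact ⟨k, Or.inr hk, hxk⟩
    · exact ⟨_, Or.inl rfl, hx⟩
  · rintro k (rfl | hk)
    · have h0 : ∀ x ∈ (interior K.space)ᶜ, φ y x = 0 := fun x hx => by
        by_contra h
        exact hx (hK.mem_interior_of_hat_ne_zero hφ hy hyi h)
      refine LipschitzOnWith.of_dist_le_mul fun a ha b hb => ?_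
      rw [h0 a ha, h0 b hb, dist_self]
      positivity
    · exact (hC k hk).weaken (hB ⟨k, hk, rfl⟩)

end Hat

/-! ### Elliptic projections of convergent sequences -/

section Projection

variable {d : ℕ}

/-- `w` is differentiable almost everywhere in `Ω`, and `w` and its gradient are essentially bounded
by `c`. -/
def C1Bound (Ω : Set (E d)) (w : E d → ℝ) (c : ℝ) : Prop :=
  ∀ᵐ x ∂(volume.restrict Ω), DifferentiableAt ℝ w x ∧ |w x| ≤ c ∧ ‖gradient w x‖ ≤ c

theorem norm_gradient_sub (u v : E d → ℝ) (x : E d) :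
    ‖gradient u x - gradient v x‖ = ‖fderiv ℝ u x - fderiv ℝ v x‖ := by
  rw [gradient, gradient, ← map_sub, LinearIsometryEquiv.norm_map]

theorem gradient_add {u v : E d → ℝ} {x : E d} (hu : DifferentiableAt ℝ u x)
    (hv : DifferentiableAt ℝ v x) : gradient (u + v) x = gradient u x + gradient v x := by
  rw [gradient, fderiv_add hu hv, map_add, gradient, gradient]

theorem gradient_sub {u v : E d → ℝ} {x : E d} (hu : DifferentiableAt ℝ u x)
    (hv : DifferentiableAt ℝ v x) : gradient (u - v) x = gradient u x - gradient v x := by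
  rw [gradient, fderiv_sub hu hv, map_sub, gradient, gradient]

theorem C1Bound.mono {Ω : Set (E d)} {w : E d → ℝ} {a b : ℝ} (h : C1Bound Ω w a) (hab : a ≤ b) :
    C1Bound Ω w b := by
  filter_upwards [h] with x ⟨h1, h2, h3⟩ using ⟨h1, h2.trans hab, h3.trans hab⟩

theorem C1Bound.add {Ω : Set (E d)} {u v : E d → ℝ} {a b : ℝ} (hu : C1Bound Ω u a)
    (hv : C1Bound Ω v b) : C1Bound Ω (u + v) (a + b) := by
  filter_upwards [hu, hv] with x ⟨h1, h2, h3⟩ ⟨k1, k2, k3⟩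
  refine ⟨h1.add k1, (abs_add_le _ _).trans (add_le_add h2 k2), ?_⟩
  rw [gradient_add h1 k1]
  exact (norm_add_le _ _).trans (add_le_add h3 k3)

theorem C1Bound.of_forall_mem {Ω : Set (E d)} (hΩ : MeasurableSet Ω) {u v : E d → ℝ} {c : ℝ}
    (hu : Differentiable ℝ u) (hv : Differentiable ℝ v)
    (h : ∀ x ∈ Ω, |u x - v x| ≤ c ∧ ‖gradient u x - gradient v x‖ ≤ c) : C1Bound Ω (u - v) c := by
  filter_upwards [ae_restrict_mem hΩ] with x hx
  refine ⟨(hu x).sub (hv x), (h x hx).1, ?_⟩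
  rw [gradient_sub (hu x) (hv x)]
  exact (h x hx).2

theorem C1Bound.W1inf_le {Ω : Set (E d)} {w : E d → ℝ} {c : ℝ} (h : C1Bound Ω w c) :
    W1inf Ω w ≤ 2 * ENNReal.ofReal c := by
  rw [W1inf, two_mul, eLpNorm_exponent_top, eLpNorm_exponent_top]
  refine add_le_add (eLpNormEssSup_le_of_ae_bound ?_) (eLpNormEssSup_le_of_ae_bound ?_)
  · filter_upwards [h] with x hx using hx.2.1
  · filter_upwards [h] with x hx using hx.2.2

/-- Differentiability has to be supplied separately: `gradient` is zero where no derivative exists,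
so the norm does not detect its absence. -/
theorem C1Bound.of_W1inf_le {Ω : Set (E d)} {w : E d → ℝ} {c : ℝ} (hc : 0 ≤ c)
    (hw : ∀ᵐ x ∂(volume.restrict Ω), DifferentiableAt ℝ w x)
    (h : W1inf Ω w ≤ ENNReal.ofReal c) : C1Bound Ω w c := by
  rw [W1inf, eLpNorm_exponent_top, eLpNorm_exponent_top] at h
  filter_upwards [hw, enorm_ae_le_eLpNormEssSup w (volume.restrict Ω),
    enorm_ae_le_eLpNormEssSup (gradient w) (volume.restrict Ω)] with x h1 h2 h3
  refine ⟨h1, ?_, ?_⟩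
  · have := (h2.trans le_self_add).trans h
    rwa [← ofReal_norm, ENNReal.ofReal_le_ofReal_iff hc] at this
  · have := (h3.trans le_add_self).trans h
    rwa [← ofReal_norm, ENNReal.ofReal_le_ofReal_iff hc] at this

variable {A : Type*} [MetricSpace A] {pb : Problem d A} {D : Scheme pb}

theorem Scheme.ae_differentiableAt (D : Scheme pb) {i : ℕ} {w : E d → ℝ} (hw : w ∈ D.V i) :
    ∀ᵐ x ∂(volume.restrict pb.Ω), DifferentiableAt ℝ w x :=
  ae_restrict_of_ae_restrict_of_subset subset_closure ((D.isMesh i).ae_differentiableAt hw)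

theorem contDiff_of_C2 (w : C2 d) : ContDiff ℝ 2 (w : E d → ℝ) := w.2

theorem differentiable_of_C2 (w : C2 d) : Differentiable ℝ (w : E d → ℝ) :=
  (contDiff_of_C2 w).differentiable (by norm_num)

/-- Approximate `w` by a smooth `v`, with an accuracy that may depend on `i`. The continuity of the
single map `P i` makes the contribution of `w - v` at most `c`, whatever its constant; uniform
stability is needed only for `v`, whose bound is `2 * c`. -/
theorem EllipticProjection.exists_C1Bound (Q : EllipticProjection D) :
    ∃ C : ℝ, 0 ≤ C ∧ ∀ i (w : C2 d) (c : ℝ), 0 < c → C1Bound pb.Ω (w : E d → ℝ) c →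
      C1Bound pb.Ω (Q.P i w : E d → ℝ) (C * c) := by
  obtain ⟨C, hC⟩ := Q.stable
  refine ⟨1 + 4 * C, by positivity, fun i w c hc hw => ?_⟩
  obtain ⟨B, hB⟩ := Q.continuous i
  -- This gives both `δ ≤ c` and `B * (2 * δ) ≤ c`; the factor 2 arises because `W1inf` adds two
  -- essential suprema.
  set δ : ℝ := c / (2 * B + 1) with hδ
  have hδ0 : 0 < δ := by positivity
  have hδc : δ ≤ c := div_le_self hc.le (by linarith [B.2])
  have hδB : B * (2 * δ) ≤ c := by
    have h1 : (2 * B + 1) * δ = c := by rw [hδ]; field_simp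
    nlinarith
  obtain ⟨v, hv, hvw⟩ := exists_contDiff_approx ((contDiff_of_C2 w).of_le (by norm_num))
    pb.domain.isBounded hδ0
  let v' : C2 d := ⟨v, contDiff_infty.1 hv 2⟩
  have h1 : C1Bound pb.Ω ((v' - w : C2 d) : E d → ℝ) δ :=
    C1Bound.of_forall_mem pb.domain.isOpen.measurableSet (differentiable_of_C2 v') (differentiable_of_C2 w) hvw
  have h1' : C1Bound pb.Ω ((w - v' : C2 d) : E d → ℝ) δ :=
    C1Bound.of_forall_mem pb.domain.isOpen.measurableSet (differentiable_of_C2 w) (differentiable_of_C2 v')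
      fun x hx => by
        rw [abs_sub_comm, norm_sub_rev]
        exact hvw x hx
  have h2 : C1Bound pb.Ω (v' : E d → ℝ) (2 * c) := by
    have := (hw.add h1).mono (b := 2 * c) (by linarith)
    rwa [← Submodule.coe_add, add_sub_cancel] at this
  have h3 : C1Bound pb.Ω (Q.P i (w - v') : E d → ℝ) c := by
    refine C1Bound.of_W1inf_le hc.le (D.ae_differentiableAt (Q.P i _).2) ((hB _).trans ?_)
    refine (mul_le_mul_right h1'.W1inf_le _).trans ?_
    rw [← ENNReal.ofReal_coe_nnreal, ← ENNReal.ofReal_ofNat, ← ENNReal.ofReal_mul (by norm_num),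
      ← ENNReal.ofReal_mul (by positivity)]
    exact ENNReal.ofReal_le_ofReal hδB
  have h4 : C1Bound pb.Ω (Q.P i v' : E d → ℝ) (4 * C * c) := by
    refine C1Bound.of_W1inf_le (by positivity) (D.ae_differentiableAt (Q.P i _).2)
      ((hC i v' hv).trans ?_)
    refine (mul_le_mul_right h2.W1inf_le _).trans ?_
    rw [← ENNReal.ofReal_coe_nnreal, ← ENNReal.ofReal_ofNat, ← ENNReal.ofReal_mul (by norm_num),
      ← ENNReal.ofReal_mul (by positivity)]
    exact ENNReal.ofReal_le_ofReal (by linarith)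
  have h5 := h3.add h4
  rw [← Submodule.coe_add, ← map_add, sub_add_cancel] at h5
  exact h5.mono (by linarith)

/-- If `w i → u` in `C¹(closure Ω)`, then the projections of `w i` converge to `u` in `W^{1,∞}`. -/
theorem EllipticProjection.eventually_C1Bound (Q : EllipticProjection D) {w : ℕ → C2 d}
    {u : E d → ℝ} (hu : ContDiff ℝ 1 u)
    (h : ∀ ε > 0, ∀ᶠ i in atTop, ∀ z ∈ closure pb.Ω,
      |(w i : E d → ℝ) z - u z| ≤ ε ∧ ‖gradient (w i : E d → ℝ) z - gradient u z‖ ≤ ε)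
    {ε : ℝ} (hε : 0 < ε) :
    ∀ᶠ i in atTop, C1Bound pb.Ω ((Q.P i (w i) : E d → ℝ) - u) ε := by
  obtain ⟨C, hC0, hC⟩ := Q.exists_C1Bound
  -- The errors are `C * (2 * δ)` for `P i (w i - v')`, `δ` for `P i v' - v'` and `δ` for `v' - u`.
  set δ : ℝ := ε / (2 * C + 2) with hδ
  have hδ0 : 0 < δ := by positivity
  have hud : Differentiable ℝ u := hu.differentiable one_ne_zero
  have hm := pb.domain.isOpen.measurableSet
  -- As `u` is only `C¹`, `P i` cannot be applied to it. A smooth function, the same for all `i`,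
  -- takes its place.
  obtain ⟨v, hv, hvu⟩ := exists_contDiff_approx hu pb.domain.isBounded hδ0
  let v' : C2 d := ⟨v, contDiff_infty.1 hv 2⟩
  have hvu' : C1Bound pb.Ω ((v' : E d → ℝ) - u) δ :=
    C1Bound.of_forall_mem hm (differentiable_of_C2 v') hud hvu
  have hconv := Q.tendsto v' hv
  have hev : ∀ᶠ i in atTop,
      W1inf pb.Ω ((Q.P i v' : E d → ℝ) - (v' : E d → ℝ)) ≤ ENNReal.ofReal δ :=
    hconv.eventually (Iic_mem_nhds (ENNReal.ofReal_pos.2 hδ0))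
  filter_upwards [hev, h δ hδ0] with i hi hwi
  have h1 : C1Bound pb.Ω ((w i - v' : C2 d) : E d → ℝ) (2 * δ) := by
    refine C1Bound.of_forall_mem hm (differentiable_of_C2 (w i)) (differentiable_of_C2 v') fun x hx => ?_
    have h1 := hwi x (subset_closure hx)
    have h2 := hvu x hx
    rw [abs_sub_comm, norm_sub_rev] at h2
    have h3 := abs_sub_le ((w i : E d → ℝ) x) (u x) (v x)
    have h4 := norm_sub_le_norm_sub_add_norm_sub (gradient (w i : E d → ℝ) x) (gradient u x)
      (gradient v x)
    exact ⟨by linarith, by linarith⟩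
  have h2 := hC i _ _ (by positivity) h1
  have h3 : C1Bound pb.Ω ((Q.P i v' : E d → ℝ) - (v' : E d → ℝ)) δ := by
    refine C1Bound.of_W1inf_le hδ0.le ?_ hi
    filter_upwards [D.ae_differentiableAt (Q.P i v').2] with x hx
    exact hx.sub (differentiable_of_C2 v' x)
  have h4 := (h2.add h3).add hvu'
  have he : (Q.P i (w i - v') : E d → ℝ) + ((Q.P i v' : E d → ℝ) - (v' : E d → ℝ))
      + ((v' : E d → ℝ) - u) = (Q.P i (w i) : E d → ℝ) - u := by
    rw [map_sub, Submodule.coe_sub]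
    abel
  rw [he] at h4
  refine h4.mono (le_of_eq ?_)
  rw [hδ]
  field_simp
  ring

/-- Nonempty open sets have positive measure, so an almost everywhere bound on a continuous function
holds on all of `Ω` and then on its closure. This yields values at boundary nodes. -/
theorem forall_mem_closure_of_ae {Ω : Set (E d)} (hΩ : IsOpen Ω) {w : E d → ℝ}
    (hw : ContinuousOn w (closure Ω)) {c : ℝ} (h : ∀ᵐ x ∂(volume.restrict Ω), |w x| ≤ c) :
    ∀ x ∈ closure Ω, |w x| ≤ c := by
  have hcl : IsClosed (closure Ω ∩ (fun x => |w x|) ⁻¹' Iic c) :=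
    hw.abs.preimage_isClosed_of_isClosed isClosed_closure isClosed_Iic
  have hsub : Ω ⊆ closure Ω ∩ (fun x => |w x|) ⁻¹' Iic c := by
    intro x hx
    rw [← hcl.closure_eq, mem_closure_iff]
    intro U hU hxU
    by_contra hcon
    rw [ae_restrict_iff' hΩ.measurableSet] at h
    refine (hU.inter hΩ).measure_ne_zero volume ⟨x, hxU, hx⟩ (measure_mono_null ?_ h)
    intro z hz hz'
    exact hcon ⟨z, hz.1, subset_closure hz.2, hz' hz.2⟩
  exact fun x hx => (closure_minimal hsub hcl hx).2

theorem C1Bound.abs_sub_le {i : ℕ} {p u : E d → ℝ} (hp : p ∈ D.V i) (hu : Continuous u) {ε : ℝ}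
    (h : C1Bound pb.Ω (p - u) ε) {x : E d} (hx : x ∈ closure pb.Ω) : |p x - u x| ≤ ε := by
  have hpc : ContinuousOn p (closure pb.Ω) := by
    rw [← (D.isMesh i).space_eq]
    exact hp.1
  exact forall_mem_closure_of_ae pb.domain.isOpen (hpc.sub hu.continuousOn)
    (by filter_upwards [h] with z hz using hz.2.1) x hx

theorem C1Bound.ae_norm_gradient_sub_le {Ω : Set (E d)} {p u : E d → ℝ} (hu : Differentiable ℝ u)
    {ε : ℝ} (h : C1Bound Ω (p - u) ε) :
    ∀ᵐ x ∂(volume.restrict Ω), ‖gradient p x - gradient u x‖ ≤ ε := by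
  filter_upwards [h] with x hx
  have hp : DifferentiableAt ℝ p x := by
    have := hx.1.add (hu x)
    rwa [sub_add_cancel] at this
  rw [← gradient_sub hp (hu x)]
  exact hx.2.2

/-- The gradient is constant on the interior of the element, which has positive measure; an almost
everywhere bound must therefore hold at one of its points. -/
theorem C1Bound.exists_norm_affineGradient_sub_le {i : ℕ} {p u : E d → ℝ}
    (hu : Differentiable ℝ u) {ε : ℝ} (h : C1Bound pb.Ω (p - u) ε) {k : Set (E d)}
    (hk : k ∈ elements (D.mesh i)) {l : E d →ᵃ[ℝ] ℝ} (hl : EqOn p l k) :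
    ∃ z ∈ k, ‖affineGradient l - gradient u z‖ ≤ ε := by
  have hsub := (D.isMesh i).interior_element_subset pb.domain.interior_closure hk
  have hae := h.ae_norm_gradient_sub_le hu
  rw [ae_restrict_iff' pb.domain.isOpen.measurableSet] at hae
  by_contra hcon
  push Not at hcon
  refine isOpen_interior.measure_ne_zero volume (interior_nonempty_of_mem_elements hk)
    (measure_mono_null ?_ hae)
  intro z hz hz'
  have h1 := hz' (hsub hz)
  rw [(hasGradientAt_of_eqOn_affineMap hl hz).gradient] at h1
  exact absurd h1 (hcon z (interior_subset hz)).not_ge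

end Projection

/-! ### Time slices of a `C²` function -/

section Slices

variable {d : ℕ} {ψ : ℝ × E d → ℝ}

theorem hasFDerivAt_comp_prodMk_right {V : Type*} [NormedAddCommGroup V] [NormedSpace ℝ V]
    {G : ℝ × E d → V} {s : ℝ} {x : E d} (hG : DifferentiableAt ℝ G (s, x)) :
    HasFDerivAt (fun z => G (s, z))
      ((fderiv ℝ G (s, x)).comp (ContinuousLinearMap.inr ℝ ℝ (E d))) x :=
  hG.hasFDerivAt.comp x (hasFDerivAt_prodMk_right s x)

theorem hasDerivAt_comp_prodMk_left {V : Type*} [NormedAddCommGroup V] [NormedSpace ℝ V]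
    {G : ℝ × E d → V} {s : ℝ} {x : E d} (hG : DifferentiableAt ℝ G (s, x)) :
    HasDerivAt (fun σ => G (σ, x)) (fderiv ℝ G (s, x) (1, 0)) s :=
  hG.hasFDerivAt.comp_hasDerivAt s ((hasDerivAt_id s).prodMk (hasDerivAt_const s x))

/-- Restriction of a functional on `ℝ × ℝ^d` to the spatial directions. -/
noncomputable def spatialPart (d : ℕ) : ((ℝ × E d) →L[ℝ] ℝ) →L[ℝ] (E d →L[ℝ] ℝ) :=
  (ContinuousLinearMap.compL ℝ (E d) (ℝ × E d) ℝ).flip (ContinuousLinearMap.inr ℝ ℝ (E d))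

theorem spatialPart_apply (T : (ℝ × E d) →L[ℝ] ℝ) (v : E d) : spatialPart d T v = T (0, v) := by
  simp [spatialPart]

theorem fderiv_slice (hψ : ContDiff ℝ 2 ψ) (s : ℝ) (x : E d) :
    fderiv ℝ (fun z => ψ (s, z)) x = spatialPart d (fderiv ℝ ψ (s, x)) :=
  (hasFDerivAt_comp_prodMk_right (hψ.differentiable (by norm_num) (s, x))).fderiv

theorem contDiff_fderiv (hψ : ContDiff ℝ 2 ψ) : ContDiff ℝ 1 (fderiv ℝ ψ) :=
  hψ.fderiv_right (by norm_num)

theorem continuous_gradient_slice (hψ : ContDiff ℝ 2 ψ) :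
    Continuous fun p : ℝ × E d => gradient (fun z => ψ (p.1, z)) p.2 := by
  simp only [gradient, fderiv_slice hψ]
  exact (LinearIsometryEquiv.continuous _).comp
    ((spatialPart d).continuous.comp (contDiff_fderiv hψ).continuous)

theorem continuous_laplacian_slice (hψ : ContDiff ℝ 2 ψ) :
    Continuous fun p : ℝ × E d => Laplacian.laplacian (fun z => ψ (p.1, z)) p.2 := by
  have h2 : Continuous (fderiv ℝ (fderiv ℝ ψ)) :=
    (contDiff_fderiv hψ).continuous_fderiv one_ne_zero
  have hdd : ∀ (p : ℝ × E d) (v : E d), fderiv ℝ (fderiv ℝ fun z => ψ (p.1, z)) p.2 v v =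
      fderiv ℝ (fderiv ℝ ψ) p (0, v) (0, v) := by
    intro p v
    have h : (fderiv ℝ fun z => ψ (p.1, z)) = fun x => spatialPart d (fderiv ℝ ψ (p.1, x)) :=
      funext fun x => fderiv_slice hψ p.1 x
    have hd : HasFDerivAt (fun x => spatialPart d (fderiv ℝ ψ (p.1, x))) _ p.2 :=
      (spatialPart d).hasFDerivAt.comp p.2 (hasFDerivAt_comp_prodMk_right
        ((contDiff_fderiv hψ).differentiable one_ne_zero (p.1, p.2)))
    rw [h, hd.fderiv]
    simp [spatialPart_apply]
  simp only [laplacian_eq_sum, hdd]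
  exact continuous_finsetSum _ fun j _ => (h2.clm_apply continuous_const).clm_apply continuous_const

theorem hasDerivAt_time (hψ : ContDiff ℝ 2 ψ) (s : ℝ) (x : E d) :
    HasDerivAt (fun σ => ψ (σ, x)) (fderiv ℝ ψ (s, x) (1, 0)) s := 
  hasDerivAt_comp_prodMk_left (hψ.differentiable (by norm_num) (s, x))

theorem hasDerivAt_fderiv_slice (hψ : ContDiff ℝ 2 ψ) (s : ℝ) (x : E d) :
    HasDerivAt (fun σ => fderiv ℝ (fun z => ψ (σ, z)) x)
      (spatialPart d (fderiv ℝ (fderiv ℝ ψ) (s, x) (1, 0))) s := by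
  simp only [fderiv_slice hψ]
  exact (spatialPart d).hasFDerivAt.comp_hasDerivAt s (hasDerivAt_comp_prodMk_left
    ((contDiff_fderiv hψ).differentiable one_ne_zero (s, x)))

theorem contDiff_time_deriv (hψ : ContDiff ℝ 2 ψ) (t : ℝ) :
    ContDiff ℝ 1 fun z => deriv (fun s => ψ (s, z)) t := by
  simp only [(hasDerivAt_time hψ t _).deriv]
  exact ((contDiff_fderiv hψ).comp (contDiff_const.prodMk contDiff_id)).clm_apply contDiff_const

/-- Symmetry of the second derivative of `ψ` interchanges the time and space derivatives. -/
theorem fderiv_time_deriv (hψ : ContDiff ℝ 2 ψ) (t : ℝ) (x : E d) :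
    fderiv ℝ (fun z => deriv (fun s => ψ (s, z)) t) x =
      spatialPart d (fderiv ℝ (fderiv ℝ ψ) (t, x) (1, 0)) := by
  simp only [(hasDerivAt_time hψ t _).deriv]
  have hd : HasFDerivAt (fun z => fderiv ℝ ψ (t, z) (1, 0)) _ x :=
    (hasFDerivAt_comp_prodMk_right
      ((contDiff_fderiv hψ).differentiable one_ne_zero (t, x))).clm_apply
      (hasFDerivAt_const ((1, 0) : ℝ × E d) x)
  rw [hd.fderiv]
  have hsymm : IsSymmSndFDerivAt ℝ ψ (t, x) :=
    hψ.contDiffAt.isSymmSndFDerivAt (by simp)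
  ext v
  simpa [spatialPart_apply] using hsymm.eq (0, v) (1, 0)

theorem eventually_forall_mem_norm_sub_le {V : Type*} [NormedAddCommGroup V] {G : ℝ × E d → V}
    (hG : Continuous G) {S : Set (E d)} (hS : IsCompact S) (t : ℝ) {ε : ℝ} (hε : 0 < ε) :
    ∀ᶠ s in 𝓝 t, ∀ z ∈ S, ‖G (s, z) - G (t, z)‖ ≤ ε := by
  refine hS.eventually_forall_of_forall_eventually fun z _ => ?_
  have hc : Continuous fun p : ℝ × E d => ‖G (p.1, p.2) - G (t, p.2)‖ := by fun_prop
  have := hc.tendsto (t, z)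
  simp only [sub_self, norm_zero] at this
  exact this.eventually (Iic_mem_nhds hε)

/-- Mean value inequality for `g σ - σ • m`. -/
theorem norm_slope_sub_le {V : Type*} [NormedAddCommGroup V] [NormedSpace ℝ V] {g g' : ℝ → V}
    {s h ε : ℝ} {m : V} (hh : 0 < h) (hg : ∀ σ, HasDerivAt g (g' σ) σ)
    (hm : ∀ σ ∈ Icc s (s + h), ‖g' σ - m‖ ≤ ε) : ‖h⁻¹ • (g (s + h) - g s) - m‖ ≤ ε := by
  have hd : ∀ σ ∈ Icc s (s + h),
      HasDerivWithinAt (fun σ => g σ - σ • m) (g' σ - m) (Icc s (s + h)) σ := by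
    intro σ _
    have := (hg σ).sub ((hasDerivAt_id σ).smul_const m)
    simp only [one_smul] at this
    exact this.hasDerivWithinAt
  have h1 := (convex_Icc s (s + h)).norm_image_sub_le_of_norm_hasDerivWithin_le hd hm
    (left_mem_Icc.2 (by linarith)) (right_mem_Icc.2 (by linarith))
  have h2 : g (s + h) - (s + h) • m - (g s - s • m) = h • (h⁻¹ • (g (s + h) - g s) - m) := by
    rw [smul_sub, smul_smul, mul_inv_cancel₀ hh.ne', one_smul, add_smul]
    abel
  rw [h2, norm_smul, add_sub_cancel_left, mul_comm] at h1
  exact le_of_mul_le_mul_right h1 (by simpa using hh.ne')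

theorem eventually_slice_close (hψ : ContDiff ℝ 2 ψ) {S : Set (E d)} (hS : IsCompact S) {t : ℝ}
    {s : ℕ → ℝ} (hs : Tendsto s atTop (𝓝 t)) {ε : ℝ} (hε : 0 < ε) :
    ∀ᶠ i in atTop, ∀ z ∈ S, |(slice ψ hψ (s i) : E d → ℝ) z - ψ (t, z)| ≤ ε ∧
      ‖gradient (slice ψ hψ (s i) : E d → ℝ) z - gradient (fun z => ψ (t, z)) z‖ ≤ ε := by
  filter_upwards [hs.eventually (eventually_forall_mem_norm_sub_le hψ.continuous hS t hε),
    hs.eventually (eventually_forall_mem_norm_sub_le (continuous_gradient_slice hψ) hS t hε)]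
    with i h1 h2 z hz
  exact ⟨h1 z hz, h2 z hz⟩

/-- Values and gradients of the quotients are slopes in time, so the mean value estimate applies to
both; for the gradients it uses the continuity of the mixed second derivatives of `ψ`. -/
theorem eventually_quotient_close (hψ : ContDiff ℝ 2 ψ) {S : Set (E d)} (hS : IsCompact S) {t : ℝ}
    {s h : ℕ → ℝ} (hs : Tendsto s atTop (𝓝 t)) (h0 : ∀ i, 0 < h i) (hh : Tendsto h atTop (𝓝 0))
    {ε : ℝ} (hε : 0 < ε) :
    ∀ᶠ i in atTop, ∀ z ∈ S,
      |(((h i)⁻¹ • (slice ψ hψ (s i + h i) - slice ψ hψ (s i)) : C2 d) : E d → ℝ) z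
        - deriv (fun s => ψ (s, z)) t| ≤ ε ∧
      ‖gradient (((h i)⁻¹ • (slice ψ hψ (s i + h i) - slice ψ hψ (s i)) : C2 d) : E d → ℝ) z
        - gradient (fun z => deriv (fun s => ψ (s, z)) t) z‖ ≤ ε := by
  have hc1 : Continuous fun p => fderiv ℝ ψ p (1, 0) :=
    (contDiff_fderiv hψ).continuous.clm_apply continuous_const
  have hc2 : Continuous fun p =>
      spatialPart d (fderiv ℝ (fderiv ℝ ψ) p (1, 0)) :=
    (spatialPart d).continuous.comp
      (((contDiff_fderiv hψ).continuous_fderiv one_ne_zero).clm_apply continuous_const)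
  have hnh := (eventually_forall_mem_norm_sub_le hc1 hS t hε).and
    (eventually_forall_mem_norm_sub_le hc2 hS t hε)
  obtain ⟨δ, hδ, hball⟩ := Metric.eventually_nhds_iff.1 hnh
  have hsh : Tendsto (fun i => s i + h i) atTop (𝓝 t) := by simpa using hs.add hh
  filter_upwards [hs.eventually (Metric.ball_mem_nhds t hδ),
    hsh.eventually (Metric.ball_mem_nhds t hδ)] with i hi hi' z hz
  have hσ : ∀ σ ∈ Icc (s i) (s i + h i), dist σ t < δ := by
    intro σ hσ
    rw [Real.dist_eq, abs_lt] at hi hi'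
    rw [Real.dist_eq, abs_lt]
    exact ⟨by linarith [hσ.1], by linarith [hσ.2]⟩
  constructor
  · have := norm_slope_sub_le (h0 i) (fun σ => hasDerivAt_time hψ σ z)
      fun σ h => (hball (hσ σ h)).1 z hz
    rw [(hasDerivAt_time hψ t z).deriv]
    exact this
  · have := norm_slope_sub_le (h0 i) (fun σ => hasDerivAt_fderiv_slice hψ σ z)
      fun σ h => (hball (hσ σ h)).2 z hz
    rw [norm_gradient_sub, fderiv_time_deriv hψ]
    have he : fderiv ℝ (((h i)⁻¹ • (slice ψ hψ (s i + h i) - slice ψ hψ (s i)) : C2 d) : E d → ℝ) z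
        = (h i)⁻¹ • (fderiv ℝ (fun z => ψ (s i + h i, z)) z - fderiv ℝ (fun z => ψ (s i, z)) z) := by
      rw [Submodule.coe_smul, Submodule.coe_sub, fderiv_const_smul
        ((differentiable_of_C2 _ z).sub (differentiable_of_C2 _ z)),
        fderiv_sub (differentiable_of_C2 _ z) (differentiable_of_C2 _ z)]
      rfl
    rw [he]
    exact this

end Slices

/-! ### Suprema and families of coefficients -/

section Families

/-- The supremum is nonexpansive. A bound for one family suffices, as the other inherits it. -/
theorem abs_ciSup_sub_ciSup_le {A : Type*} [Nonempty A] {u v : A → ℝ} {ε : ℝ}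
    (hv : BddAbove (range v)) (h : ∀ α, |u α - v α| ≤ ε) : |(⨆ α, u α) - ⨆ α, v α| ≤ ε := by
  have hu : BddAbove (range u) := by
    obtain ⟨B, hB⟩ := hv
    refine ⟨B + ε, ?_⟩
    rintro _ ⟨α, rfl⟩
    linarith [hB ⟨α, rfl⟩, (abs_le.1 (h α)).2]
  rw [abs_le]
  constructor
  · have : ⨆ α, v α ≤ (⨆ α, u α) + ε :=
      ciSup_le fun α => by linarith [le_ciSup hu α, (abs_le.1 (h α)).1]
    linarith
  · have : ⨆ α, u α ≤ (⨆ α, v α) + ε :=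
      ciSup_le fun α => by linarith [le_ciSup hv α, (abs_le.1 (h α)).2]
    linarith

variable {d : ℕ} {A V : Type*} [NormedAddCommGroup V] {S : Set (E d)}
  {u : A → E d → V}

theorem ContinuousFamily.continuous_apply [TopologicalSpace A] (hu : ContinuousFamily S u) {x : E d} (hx : x ∈ S) :
    Continuous fun α => u α x :=
  continuous_iff_continuousAt.2 fun α => (hu α).tendsto_at hx

/-- Continuity in `α` for the supremum norm makes `u` jointly continuous on the compact set `A × S`.
Uniform continuity there gives a modulus valid for all `α`. -/
theorem ContinuousFamily.exists_forall_norm_sub_le [MetricSpace A] [CompactSpace A] (hu : ContinuousFamily S u)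
    (hc : ∀ α, ContinuousOn (u α) S) (hS : IsCompact S) {ε : ℝ} (hε : 0 < ε) :
    ∃ δ > 0, ∀ α, ∀ x ∈ S, ∀ z ∈ S, dist x z < δ → ‖u α x - u α z‖ ≤ ε := by
  have hcont : ContinuousOn (fun p : A × E d => u p.1 p.2) (univ ×ˢ S) := by
    rintro ⟨α, x⟩ ⟨-, hx⟩
    rw [Metric.continuousWithinAt_iff']
    intro η hη
    have h1 := Metric.tendstoUniformlyOn_iff.1 (hu α) (η / 2) (half_pos hη)
    have h2 := Metric.continuousWithinAt_iff'.1 (hc α x hx) (η / 2) (half_pos hη)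
    rw [nhdsWithin_prod_eq, nhdsWithin_univ]
    filter_upwards [h1.prod_mk (h2.and self_mem_nhdsWithin)] with p hp
    have h3 := hp.1 p.2 hp.2.2
    rw [dist_comm] at h3
    have := dist_triangle (u p.1 p.2) (u α p.2) (u α x)
    linarith [hp.2.1]
  have huc := (isCompact_univ.prod hS).uniformContinuousOn_of_continuous hcont
  obtain ⟨δ, hδ, h⟩ := Metric.uniformContinuousOn_iff.1 huc ε hε
  refine ⟨δ, hδ, fun α x hx z hz hxz => ?_⟩
  have := h (α, x) ⟨mem_univ _, hx⟩ (α, z) ⟨mem_univ _, hz⟩ (by simpa [Prod.dist_eq] using hxz)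
  rw [dist_eq_norm] at this
  exact this.le

theorem ConvergesUniformly.eventually_norm_sub_le {u : ℕ → A → E d → V} {v : A → E d → V}
    (h : ConvergesUniformly S u v) {ε : ℝ} (hε : 0 < ε) :
    ∀ᶠ i in atTop, ∀ α, ∀ x ∈ S, ‖u i α x - v α x‖ ≤ ε := by
  filter_upwards [Metric.tendstoUniformlyOn_iff.1 h ε hε] with i hi α x hx
  have := hi (α, x) ⟨mem_univ _, hx⟩
  rw [dist_comm, dist_eq_norm] at this
  exact this.le

theorem ConvergesUniformly.eventually_norm_sub_le_of_dist [MetricSpace A] [CompactSpace A]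
    {u : ℕ → A → E d → V} {v : A → E d → V} (h : ConvergesUniformly S u v)
    (hv : ContinuousFamily S v) (hc : ∀ α, ContinuousOn (v α) S) (hS : IsCompact S)
    {r : ℕ → ℝ} (hr : Tendsto r atTop (𝓝 0)) {ε : ℝ} (hε : 0 < ε) :
    ∀ᶠ i in atTop, ∀ α, ∀ y ∈ S, ∀ x ∈ S, dist x y ≤ r i → ‖u i α x - v α y‖ ≤ ε := by
  obtain ⟨δ, hδ, hvδ⟩ := hv.exists_forall_norm_sub_le hc hS (half_pos hε)
  filter_upwards [h.eventually_norm_sub_le (half_pos hε), hr.eventually (Iio_mem_nhds hδ)]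
    with i hi hri α y hy x hx hxy
  have h1 := hi α x hx
  have h2 := hvδ α x hx y hy (lt_of_le_of_lt hxy hri)
  have h3 := norm_sub_le_norm_sub_add_norm_sub (u i α x) (v α x) (v α y)
  linarith

end Families

/-! ### Normalised hat functions and the rows of the scheme -/

section Rows

variable {d : ℕ} {A : Type*} [MetricSpace A] {pb : Problem d A}

namespace Scheme

theorem interior_space (D : Scheme pb) (i : ℕ) : interior (D.mesh i).space = pb.Ω := by
  rw [(D.isMesh i).space_eq, pb.domain.interior_closure]

theorem vertices_subset_closure (D : Scheme pb) (i : ℕ) : (D.mesh i).vertices ⊆ closure pb.Ω := by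
  rw [← (D.isMesh i).space_eq]
  exact Geometry.SimplicialComplex.vertices_subset_space

variable {D : Scheme pb} {i : ℕ} {y : E d}

theorem mem_of_hat_ne_zero (hy : y ∈ (D.mesh i).vertices) (hyΩ : y ∈ pb.Ω) {x : E d}
    (hx : D.φ i y x ≠ 0) : x ∈ pb.Ω := by
  rw [← D.interior_space i] at hyΩ ⊢
  exact (D.isMesh i).mem_interior_of_hat_ne_zero (D.isHat i) hy hyΩ hx

theorem continuous_hat (hy : y ∈ (D.mesh i).vertices) (hyΩ : y ∈ pb.Ω) :
    Continuous (D.φ i y) := by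
  rw [← D.interior_space i] at hyΩ
  exact (D.isMesh i).continuous_hat (D.isHat i) hy hyΩ

theorem hasCompactSupport_hat (hy : y ∈ (D.mesh i).vertices) (hyΩ : y ∈ pb.Ω) :
    HasCompactSupport (D.φ i y) :=
  HasCompactSupport.of_support_subset_isCompact pb.domain.isBounded.isCompact_closure
    fun _ hx => subset_closure (mem_of_hat_ne_zero hy hyΩ hx)

theorem integral_abs_hat_pos (hy : y ∈ (D.mesh i).vertices) (hyΩ : y ∈ pb.Ω) :
    0 < ∫ z in pb.Ω, |D.φ i y z| := by
  rw [setIntegral_eq_integral_of_forall_compl_eq_zero fun x hx => by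
    by_contra h
    exact hx (mem_of_hat_ne_zero hy hyΩ (abs_ne_zero.1 h))]
  refine (continuous_hat hy hyΩ).abs.integral_pos_of_hasCompactSupport_nonneg_nonzero
    ((hasCompactSupport_hat hy hyΩ).comp_left abs_zero) (fun _ => abs_nonneg _) (x := y) ?_
  rw [(D.isHat i y hy).2.1]
  simp

theorem φhat_nonneg (hy : y ∈ (D.mesh i).vertices) (x : E d) : 0 ≤ D.φhat i y x :=
  div_nonneg ((D.isMesh i).hat_nonneg (D.isHat i) hy x) (integral_nonneg fun _ => abs_nonneg _)

theorem hat_ne_zero_of_φhat_ne_zero {x : E d} (hx : D.φhat i y x ≠ 0) : D.φ i y x ≠ 0 :=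
  fun h => hx (by rw [φhat, h, zero_div])

theorem dist_le_of_φhat_ne_zero (hy : y ∈ (D.mesh i).vertices) {x : E d}
    (hx : D.φhat i y x ≠ 0) : dist x y ≤ meshSize (D.mesh i) := by
  obtain ⟨k, hk, hyk, hxk⟩ := (D.isMesh i).exists_element_of_hat_ne_zero (D.isHat i) hy
    (hat_ne_zero_of_φhat_ne_zero hx)
  exact (D.isMesh i).dist_le_meshSize hk hxk hyk

theorem continuous_φhat (hy : y ∈ (D.mesh i).vertices) (hyΩ : y ∈ pb.Ω) :
    Continuous (D.φhat i y) :=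
  (continuous_hat hy hyΩ).div_const _

theorem hasCompactSupport_φhat (hy : y ∈ (D.mesh i).vertices) (hyΩ : y ∈ pb.Ω) :
    HasCompactSupport (D.φhat i y) :=
  (hasCompactSupport_hat hy hyΩ).comp_left (g := fun r => r / ∫ z in pb.Ω, |D.φ i y z|)
    (zero_div _)

theorem integrableOn_φhat (hy : y ∈ (D.mesh i).vertices) (hyΩ : y ∈ pb.Ω) :
    IntegrableOn (D.φhat i y) pb.Ω :=
  ((continuous_φhat hy hyΩ).integrable_of_hasCompactSupport
    (hasCompactSupport_φhat hy hyΩ)).integrableOn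

theorem integral_φhat (hy : y ∈ (D.mesh i).vertices) (hyΩ : y ∈ pb.Ω) :
    ∫ z in pb.Ω, D.φhat i y z = 1 := by
  simp only [φhat]
  rw [integral_div]
  have h : ∫ z in pb.Ω, D.φ i y z = ∫ z in pb.Ω, |D.φ i y z| :=
    integral_congr_ae (Eventually.of_forall fun z =>
      (abs_of_nonneg ((D.isMesh i).hat_nonneg (D.isHat i) hy z)).symm)
  rw [h, div_self (integral_abs_hat_pos hy hyΩ).ne']

theorem exists_lipschitzWith_φhat (hy : y ∈ (D.mesh i).vertices) (hyΩ : y ∈ pb.Ω) :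
    ∃ C, LipschitzWith C (D.φhat i y) := by
  have hyi := hyΩ
  rw [← D.interior_space i] at hyi
  obtain ⟨C, hC⟩ := (D.isMesh i).exists_lipschitzWith_hat (D.isHat i) hy hyi
  set m := ∫ z in pb.Ω, |D.φ i y z| with hm
  refine ⟨‖m⁻¹‖₊ * C, ?_⟩
  have : D.φhat i y = fun x => m⁻¹ • D.φ i y x := by
    ext x
    rw [φhat, smul_eq_mul, div_eq_inv_mul]
  rw [this]
  exact (lipschitzWith_smul m⁻¹).comp hC

/-- Integration by parts against a normalised hat function of an interior node. -/
theorem gradInner_φhat (hy : y ∈ (D.mesh i).vertices) (hyΩ : y ∈ pb.Ω) {w : E d → ℝ}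
    (hw : ContDiff ℝ 2 w) :
    gradInner pb w (D.φhat i y) = -∫ x in pb.Ω, Laplacian.laplacian w x * D.φhat i y x := by
  obtain ⟨C, hC⟩ := exists_lipschitzWith_φhat hy hyΩ
  have h0 : ∀ x ∉ pb.Ω, D.φhat i y x = 0 := fun x hx => by
    by_contra h
    exact hx (mem_of_hat_ne_zero hy hyΩ (hat_ne_zero_of_φhat_ne_zero h))
  -- Off `Ω` the nonnegative function `φhat` attains its minimum 0, so `fderiv` is zero, by Fermat's
  -- rule or as the default value at a kink. Both integrals thus extend to the whole space.
  have hg0 : ∀ x ∉ pb.Ω, gradient (D.φhat i y) x = 0 := fun x hx => by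
    have hmin : IsLocalMin (D.φhat i y) x :=
      Eventually.of_forall fun z => by
        rw [h0 x hx]
        exact φhat_nonneg hy z
    rw [gradient, hmin.fderiv_eq_zero, map_zero]
  rw [gradInner, setIntegral_eq_integral_of_forall_compl_eq_zero fun x hx => by
      rw [hg0 x hx, inner_zero_right],
    setIntegral_eq_integral_of_forall_compl_eq_zero fun x hx => by rw [h0 x hx, mul_zero]]
  exact integral_inner_gradient hw hC (hasCompactSupport_φhat hy hyΩ)

theorem integrableOn_mul_φhat (hy : y ∈ (D.mesh i).vertices) (hyΩ : y ∈ pb.Ω) {g : E d → ℝ}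
    (hg : AEStronglyMeasurable g (volume.restrict pb.Ω)) {B : ℝ}
    (h : ∀ᵐ x ∂(volume.restrict pb.Ω), dist x y ≤ meshSize (D.mesh i) → |g x| ≤ B) :
    IntegrableOn (fun x => g x * D.φhat i y x) pb.Ω := by
  have hφ := integrableOn_φhat hy hyΩ
  refine (hφ.const_mul B).mono' (hg.mul hφ.aestronglyMeasurable) ?_
  filter_upwards [h] with x hx
  rw [Real.norm_eq_abs, abs_mul, abs_of_nonneg (φhat_nonneg hy x)]
  by_cases h0 : D.φhat i y x = 0
  · simp [h0]
  · exact mul_le_mul_of_nonneg_right (hx (dist_le_of_φhat_ne_zero hy h0)) (φhat_nonneg hy x)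

/-- Averages with respect to a normalised hat function. -/
theorem abs_integral_mul_φhat_sub_le (hy : y ∈ (D.mesh i).vertices) (hyΩ : y ∈ pb.Ω)
    {g : E d → ℝ} (hg : AEStronglyMeasurable g (volume.restrict pb.Ω)) {m ε : ℝ}
    (h : ∀ᵐ x ∂(volume.restrict pb.Ω), dist x y ≤ meshSize (D.mesh i) → |g x - m| ≤ ε) :
    |(∫ x in pb.Ω, g x * D.φhat i y x) - m| ≤ ε := by
  have hφ := integrableOn_φhat hy hyΩ
  have hI : IntegrableOn (fun x => g x * D.φhat i y x) pb.Ω := by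
    refine integrableOn_mul_φhat hy hyΩ hg (B := |m| + ε) ?_
    filter_upwards [h] with x hx hxy
    have := abs_sub_abs_le_abs_sub (g x) m
    linarith [hx hxy]
  have h1 : (∫ x in pb.Ω, g x * D.φhat i y x) - m =
      ∫ x in pb.Ω, (g x * D.φhat i y x - m * D.φhat i y x) := by
    rw [integral_sub hI (hφ.const_mul m), integral_const_mul, integral_φhat hy hyΩ, mul_one]
  have h2 : ε = ∫ x in pb.Ω, ε * D.φhat i y x := by
    rw [integral_const_mul, integral_φhat hy hyΩ, mul_one]
  rw [h1, h2, ← Real.norm_eq_abs]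
  refine norm_integral_le_of_norm_le (hφ.const_mul ε) ?_
  filter_upwards [h] with x hx
  rw [← sub_mul, Real.norm_eq_abs, abs_mul, abs_of_nonneg (φhat_nonneg hy x)]
  by_cases h0 : D.φhat i y x = 0
  · simp [h0]
  · exact mul_le_mul_of_nonneg_right (hx (dist_le_of_φhat_ne_zero hy h0)) (φhat_nonneg hy x)

end Scheme

/-- Perturbation estimate for a first order operator split in two parts. -/
theorem abs_split_sub_le {bE bI b g₀ g₁ P : E d} {cE cI c v₀ v₁ S f f' M η : ℝ}
    (hbE : ‖bE‖ ≤ M) (hbI : ‖bI‖ ≤ M) (hcE : |cE| ≤ M) (hcI : |cI| ≤ M)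
    (hg₀ : ‖g₀ - P‖ ≤ η) (hg₁ : ‖g₁ - P‖ ≤ η) (hv₀ : |v₀ - S| ≤ η) (hv₁ : |v₁ - S| ≤ η)
    (hb : ‖bE + bI - b‖ ≤ η) (hc : |cE + cI - c| ≤ η) (hf : |f' - f| ≤ η) :
    |(-(inner ℝ bE g₁) + cE * v₁) + (-(inner ℝ bI g₀) + cI * v₀) - f' -
      (-(inner ℝ b P) + c * S - f)| ≤ η * (4 * M + ‖P‖ + |S| + 1) := by
  have hM : 0 ≤ M := (norm_nonneg _).trans hbE
  have hη : 0 ≤ η := (norm_nonneg _).trans hg₀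
  -- Explicit and implicit parts are compared with the same `P` and `S`, so only the sums of the
  -- split coefficients have to be close to the limit coefficients. The four terms with a single
  -- split coefficient produce `4 * M`.
  have e : (-(inner ℝ bE g₁) + cE * v₁) + (-(inner ℝ bI g₀) + cI * v₀) - f' -
      (-(inner ℝ b P) + c * S - f) =
      -(inner ℝ bE (g₁ - P)) - inner ℝ bI (g₀ - P) - inner ℝ (bE + bI - b) P
        + cE * (v₁ - S) + cI * (v₀ - S) + (cE + cI - c) * S - (f' - f) := by
    simp only [inner_sub_right, inner_sub_left, inner_add_left]
    ring
  have key : ∀ {u v : E d} {a b : ℝ}, ‖u‖ ≤ a → ‖v‖ ≤ b → |inner ℝ u v| ≤ a * b :=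
    fun {u v a b} hu hv => (abs_real_inner_le_norm u v).trans
      (mul_le_mul hu hv (norm_nonneg _) ((norm_nonneg _).trans hu))
  have key' : ∀ {u v a b : ℝ}, |u| ≤ a → |v| ≤ b → |u * v| ≤ a * b := fun {u v a b} hu hv => by
    rw [abs_mul]
    exact mul_le_mul hu hv (abs_nonneg _) ((abs_nonneg _).trans hu)
  have h1 := abs_le.1 (key hbE hg₁)
  have h2 := abs_le.1 (key hbI hg₀)
  have h3 := abs_le.1 (key hb le_rfl : |inner ℝ _ P| ≤ η * ‖P‖)
  have h4 := abs_le.1 (key' hcE hv₁)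
  have h5 := abs_le.1 (key' hcI hv₀)
  have h6 := abs_le.1 (key' hc le_rfl : |_ * S| ≤ η * |S|)
  have h7 := abs_le.1 hf
  rw [e, abs_le]
  constructor <;> nlinarith

theorem measurable_gradient (w : E d → ℝ) : Measurable (gradient w) :=
  (LinearIsometryEquiv.continuous _).measurable.comp (measurable_fderiv ℝ w)

variable {D : Scheme pb} {i : ℕ} {y : E d}

/-- Consistency of the row of an interior node. -/
theorem EllipticProjection.abs_row_interior_sub_le (Q : EllipticProjection D)
    (hy : y ∈ (D.mesh i).vertices) (hyΩ : y ∈ pb.Ω) {w₀ w₁ : C2 d} {α : A} {P : E d}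
    {S q M η : ℝ}
    (hM : ∀ x ∈ closure pb.Ω, |D.aE i α x| ≤ M ∧ |D.aI i α x| ≤ M ∧ ‖D.bE i α x‖ ≤ M ∧
      ‖D.bI i α x‖ ≤ M ∧ |D.cE i α x| ≤ M ∧ |D.cI i α x| ≤ M)
    (h₀ : ∀ᵐ x ∂(volume.restrict pb.Ω), dist x y ≤ meshSize (D.mesh i) →
      ‖gradient (Q.P i w₀ : E d → ℝ) x - P‖ ≤ η ∧ |(Q.P i w₀ : E d → ℝ) x - S| ≤ η)
    (h₁ : ∀ᵐ x ∂(volume.restrict pb.Ω), dist x y ≤ meshSize (D.mesh i) →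
      ‖gradient (Q.P i w₁ : E d → ℝ) x - P‖ ≤ η ∧ |(Q.P i w₁ : E d → ℝ) x - S| ≤ η)
    (hΔ : ∀ x, dist x y ≤ meshSize (D.mesh i) →
      |Laplacian.laplacian (w₀ : E d → ℝ) x - q| ≤ η ∧
        |Laplacian.laplacian (w₁ : E d → ℝ) x - q| ≤ η)
    (ha : |pb.a α y - (D.aE i α y + D.aI i α y)| ≤ η)
    (hbcf : ∀ x ∈ pb.Ω, dist x y ≤ meshSize (D.mesh i) →
      ‖D.bE i α x + D.bI i α x - pb.b α y‖ ≤ η ∧ |D.cE i α x + D.cI i α x - pb.c α y| ≤ η ∧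
        |D.f i α x - pb.f α y| ≤ η) :
    |D.opE i α (Q.P i w₁ : E d → ℝ) y + D.opI i α (Q.P i w₀ : E d → ℝ) y - D.opF i α y
      - (pb.L α y q P S - pb.f α y)| ≤ η * (6 * M + ‖P‖ + |S| + |q| + 1) := by
  have hm := pb.domain.isOpen.measurableSet
  have hyF : y ∉ frontier pb.Ω := fun h => h.2 (by rwa [pb.domain.isOpen.interior_eq])
  have hyB : y ∉ pb.Γt ∪ pb.ΓR := fun h => hyF (by
    rw [← pb.boundary_eq]
    rcases h with h | h
    exacts [Or.inr h, Or.inl (Or.inr h)])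
  have hyD : y ∉ pb.ΓD := fun h => hyF (by
    rw [← pb.boundary_eq]
    exact Or.inl (Or.inl h))
  have hη : 0 ≤ η := (abs_nonneg _).trans ha
  -- Orthogonality replaces the projection by `w`, and integration by parts leaves minus the average
  -- of its Laplacian; hence the sign of `q`.
  have hlap : ∀ w : C2 d, (∀ x, dist x y ≤ meshSize (D.mesh i) →
      |Laplacian.laplacian (w : E d → ℝ) x - q| ≤ η) →
      |Scheme.gradInner pb (Q.P i w : E d → ℝ) (D.φhat i y) + q| ≤ η := by
    intro w hw
    have hc : Continuous (Laplacian.laplacian (w : E d → ℝ)) := by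
      have h2 : Continuous (fderiv ℝ (fderiv ℝ (w : E d → ℝ))) :=
        ((contDiff_of_C2 w).fderiv_right (m := 1) (by norm_num)).continuous_fderiv one_ne_zero
      have : Laplacian.laplacian (w : E d → ℝ) = fun x => _ := funext fun x => laplacian_eq_sum _ x
      rw [this]
      exact continuous_finsetSum _ fun j _ =>
        (h2.clm_apply continuous_const).clm_apply continuous_const
    have := Scheme.abs_integral_mul_φhat_sub_le hy hyΩ (g := Laplacian.laplacian (w : E d → ℝ))
      (m := q) (ε := η) hc.aestronglyMeasurable (Eventually.of_forall hw)
    rw [Q.orthogonal i w y hy hyΩ, Scheme.gradInner_φhat hy hyΩ (contDiff_of_C2 w), neg_add_eq_sub,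
      abs_sub_comm]
    exact this
  have hG₀ := hlap w₀ fun x hx => (hΔ x hx).1
  have hG₁ := hlap w₁ fun x hx => (hΔ x hx).2
  set G₀ := Scheme.gradInner pb (Q.P i w₀ : E d → ℝ) (D.φhat i y)
  set G₁ := Scheme.gradInner pb (Q.P i w₁ : E d → ℝ) (D.φhat i y)
  have hmeas : ∀ (b : E d → E d) (c : E d → ℝ) (w : C2 d), ContinuousOn b (closure pb.Ω) →
      ContinuousOn c (closure pb.Ω) → AEStronglyMeasurable
        (fun x => -(inner ℝ (b x) (gradient (Q.P i w : E d → ℝ) x)) +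
          c x * (Q.P i w : E d → ℝ) x) (volume.restrict pb.Ω) := by
    intro b c w hb hc
    have hpc : ContinuousOn (Q.P i w : E d → ℝ) (closure pb.Ω) := by
      rw [← (D.isMesh i).space_eq]
      exact (Q.P i w).2.1
    have hb' := (hb.mono subset_closure).aestronglyMeasurable hm (μ := volume)
    exact (hb'.inner (measurable_gradient _).aestronglyMeasurable).neg.add
      (((hc.mul hpc).mono subset_closure).aestronglyMeasurable hm)
  have hbound : ∀ (b : E d → E d) (c : E d → ℝ) (w : C2 d),
      (∀ x ∈ closure pb.Ω, ‖b x‖ ≤ M ∧ |c x| ≤ M) →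
      (∀ᵐ x ∂(volume.restrict pb.Ω), dist x y ≤ meshSize (D.mesh i) →
      ‖gradient (Q.P i w : E d → ℝ) x - P‖ ≤ η ∧ |(Q.P i w : E d → ℝ) x - S| ≤ η) →
      ∀ᵐ x ∂(volume.restrict pb.Ω), dist x y ≤ meshSize (D.mesh i) →
        |-(inner ℝ (b x) (gradient (Q.P i w : E d → ℝ) x)) + c x * (Q.P i w : E d → ℝ) x|
          ≤ M * (‖P‖ + η) + M * (|S| + η) := by
    intro b c w hbc hw
    filter_upwards [hw, ae_restrict_mem hm] with x hx hxΩ hxy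
    obtain ⟨k1, k2⟩ := hx hxy
    obtain ⟨m1, m2⟩ := hbc x (subset_closure hxΩ)
    have hM0 : 0 ≤ M := (norm_nonneg _).trans m1
    have n1 : ‖gradient (Q.P i w : E d → ℝ) x‖ ≤ ‖P‖ + η := by
      have := norm_sub_norm_le (gradient (Q.P i w : E d → ℝ) x) P
      linarith
    have n2 : |(Q.P i w : E d → ℝ) x| ≤ |S| + η := by
      have := abs_sub_abs_le_abs_sub ((Q.P i w : E d → ℝ) x) S
      linarith
    refine (abs_add_le _ _).trans (add_le_add ?_ ?_)
    · rw [abs_neg]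
      exact (abs_real_inner_le_norm _ _).trans (mul_le_mul m1 n1 (norm_nonneg _) hM0)
    · rw [abs_mul]
      exact mul_le_mul m2 n2 (abs_nonneg _) hM0
  have mE := hmeas _ _ w₁ (D.bE_cont i α) (D.cE_cont i α)
  have mI := hmeas _ _ w₀ (D.bI_cont i α) (D.cI_cont i α)
  have mF : AEStronglyMeasurable (D.f i α) (volume.restrict pb.Ω) :=
    ((D.f_cont i α).mono subset_closure).aestronglyMeasurable hm
  have iE := Scheme.integrableOn_mul_φhat hy hyΩ mE
    (hbound _ _ w₁ (fun x hx => ⟨(hM x hx).2.2.1, (hM x hx).2.2.2.2.1⟩) h₁)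
  have iI := Scheme.integrableOn_mul_φhat hy hyΩ mI
    (hbound _ _ w₀ (fun x hx => ⟨(hM x hx).2.2.2.1, (hM x hx).2.2.2.2.2⟩) h₀)
  have iF : IntegrableOn (fun x => D.f i α x * D.φhat i y x) pb.Ω := by
    refine Scheme.integrableOn_mul_φhat hy hyΩ mF (B := |pb.f α y| + η) ?_
    filter_upwards [ae_restrict_mem hm] with x hx hxy
    have := abs_sub_abs_le_abs_sub (D.f i α x) (pb.f α y)
    linarith [(hbcf x hx hxy).2.2]
  -- The explicit, implicit and source terms are averaged together, because the split coefficients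
  -- have no limits separately.
  have havg := Scheme.abs_integral_mul_φhat_sub_le hy hyΩ ((mE.add mI).sub mF)
    (m := -(inner ℝ (pb.b α y) P) + pb.c α y * S - pb.f α y)
    (ε := η * (4 * M + ‖P‖ + |S| + 1)) (by
      filter_upwards [h₀, h₁, ae_restrict_mem hm] with x hx₀ hx₁ hxΩ hxy
      obtain ⟨-, -, m1, m2, m3, m4⟩ := hM x (subset_closure hxΩ)
      obtain ⟨k1, k2, k3⟩ := hbcf x hxΩ hxy
      exact abs_split_sub_le m1 m2 m3 m4 (hx₀ hxy).1 (hx₁ hxy).1 (hx₀ hxy).2 (hx₁ hxy).2 k1 k2 k3)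
  have hsplit : (∫ x in pb.Ω, (-(inner ℝ (D.bE i α x) (gradient (Q.P i w₁ : E d → ℝ) x)) +
          D.cE i α x * (Q.P i w₁ : E d → ℝ) x) * D.φhat i y x) +
        (∫ x in pb.Ω, (-(inner ℝ (D.bI i α x) (gradient (Q.P i w₀ : E d → ℝ) x)) +
          D.cI i α x * (Q.P i w₀ : E d → ℝ) x) * D.φhat i y x) -
        ∫ x in pb.Ω, D.f i α x * D.φhat i y x =
      ∫ x in pb.Ω, ((-(inner ℝ (D.bE i α x) (gradient (Q.P i w₁ : E d → ℝ) x)) +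
          D.cE i α x * (Q.P i w₁ : E d → ℝ) x) +
        (-(inner ℝ (D.bI i α x) (gradient (Q.P i w₀ : E d → ℝ) x)) +
          D.cI i α x * (Q.P i w₀ : E d → ℝ) x) - D.f i α x) * D.φhat i y x := by
    rw [← integral_add iE iI]
    refine (integral_sub (iE.add iI) iF).symm.trans (integral_congr_ae (Eventually.of_forall fun x => ?_))
    simp only [Pi.add_apply]
    ring
  obtain ⟨m1, m2, -⟩ := hM y (subset_closure hyΩ)
  have hM0 : 0 ≤ M := (abs_nonneg _).trans m1
  have e1 := abs_le.1 ((abs_mul (D.aE i α y) (G₁ + q)).le.trans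
    (mul_le_mul m1 hG₁ (abs_nonneg _) hM0))
  have e2 := abs_le.1 ((abs_mul (D.aI i α y) (G₀ + q)).le.trans
    (mul_le_mul m2 hG₀ (abs_nonneg _) hM0))
  have e3 := abs_le.1 ((abs_mul (pb.a α y - (D.aE i α y + D.aI i α y)) q).le.trans
    (mul_le_mul_of_nonneg_right ha (abs_nonneg _)))
  have e4 := abs_le.1 havg
  simp only [Pi.add_apply, Pi.sub_apply] at e4
  rw [← hsplit] at e4
  simp only [Scheme.opE, Scheme.opI, Scheme.opF, Scheme.opEΩ, Scheme.opIΩ, Scheme.opFΩ, Scheme.opEB,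
    Scheme.opIB, Scheme.opFB, if_pos hyΩ, if_neg hyB, if_neg hyD, add_zero, Scheme.weakForm,
    Problem.L]
  rw [abs_le]
  constructor <;> nlinarith [e4.1, e4.2]

/-- Consistency of the row of a Robin node. -/
theorem Scheme.abs_row_boundary_sub_le (hy : y ∈ (D.mesh i).vertices) (hyB : y ∈ pb.Γt ∪ pb.ΓR)
    {p₀ p₁ : E d → ℝ} (hp₀ : p₀ ∈ D.V i) (hp₁ : p₁ ∈ D.V i) {α : A} {P : E d} {S M η : ℝ}
    (hM : ∀ x ∈ frontier pb.Ω, ‖D.bBE i α x‖ ≤ M ∧ ‖D.bBI i α x‖ ≤ M ∧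
      |D.cBE i α x| ≤ M ∧ |D.cBI i α x| ≤ M)
    (h₀ : ∀ k ∈ elements (D.mesh i), y ∈ k → ∀ l : E d →ᵃ[ℝ] ℝ, EqOn p₀ l k →
      ‖affineGradient l - P‖ ≤ η)
    (h₁ : ∀ k ∈ elements (D.mesh i), y ∈ k → ∀ l : E d →ᵃ[ℝ] ℝ, EqOn p₁ l k →
      ‖affineGradient l - P‖ ≤ η)
    (hS₀ : |p₀ y - S| ≤ η) (hS₁ : |p₁ y - S| ≤ η)
    (hb : ‖D.bBE i α y + D.bBI i α y - pb.bB α y‖ ≤ η)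
    (hc : |D.cBE i α y + D.cBI i α y - pb.cB α y| ≤ η) (hg : |D.gB i α y - pb.gB α y| ≤ η) :
    |D.opE i α p₁ y + D.opI i α p₀ y - D.opF i α y - (pb.LB α y P S - pb.gB α y)|
      ≤ η * (4 * M + ‖P‖ + |S| + 1) := by
  have hyF : y ∈ frontier pb.Ω := by
    rw [← pb.boundary_eq]
    rcases hyB with h | h
    exacts [Or.inr h, Or.inl (Or.inr h)]
  have hyΩ : y ∉ pb.Ω := fun h => hyF.2 (by rwa [pb.domain.isOpen.interior_eq])
  -- The explicit and implicit directions may enter different elements; the gradients on both are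
  -- close to `P`.
  obtain ⟨k₁, hk₁, hyk₁, hd₁⟩ := (D.isMesh i).exists_element_dini (D.bBE_cone i α y hy hyB)
  obtain ⟨k₀, hk₀, hyk₀, hd₀⟩ := (D.isMesh i).exists_element_dini (D.bBI_cone i α y hy hyB)
  obtain ⟨l₁, hl₁⟩ := hp₁.2.1 k₁ hk₁
  obtain ⟨l₀, hl₀⟩ := hp₀.2.1 k₀ hk₀
  obtain ⟨m1, m2, m3, m4⟩ := hM y hyF
  have := abs_split_sub_le m1 m2 m3 m4 (h₀ k₀ hk₀ hyk₀ l₀ hl₀) (h₁ k₁ hk₁ hyk₁ l₁ hl₁) hS₀ hS₁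
    hb hc hg
  simp only [Scheme.opE, Scheme.opI, Scheme.opF, Scheme.opEΩ, Scheme.opIΩ, Scheme.opFΩ, Scheme.opEB,
    Scheme.opIB, Scheme.opFB, if_neg hyΩ, if_pos hyB, zero_add, Problem.LB, hd₁ p₁ l₁ hl₁,
    hd₀ p₀ l₀ hl₀]
  rwa [real_inner_comm _ (affineGradient l₁), real_inner_comm _ (affineGradient l₀)]

end Rows

/-! ### Consistency -/

section Consistency

theorem limsup_coe_le_of_tendsto_sub {u v : ℕ → ℝ}
    (h : Tendsto (fun i => u i - v i) atTop (𝓝 0)) :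
    limsup (fun i => (u i : EReal)) atTop ≤ limsup (fun i => (v i : EReal)) atTop := by
  have h0 : limsup (fun i => ((u i - v i : ℝ) : EReal)) atTop = 0 :=
    ((continuous_coe_real_ereal.tendsto 0).comp h).limsup_eq
  have he : (fun i => (u i : EReal)) =
      (fun i => ((u i - v i : ℝ) : EReal)) + fun i => (v i : EReal) := by
    ext i
    rw [Pi.add_apply, ← EReal.coe_add, sub_add_cancel]
  rw [he]
  refine (EReal.limsup_add_le (Or.inl ?_) (Or.inl ?_)).trans ?_
  · rw [h0]
    exact EReal.zero_ne_bot
  · rw [h0]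
    exact EReal.zero_ne_top
  · rw [h0, zero_add]

theorem le_liminf_coe_of_tendsto_sub {u v : ℕ → ℝ}
    (h : Tendsto (fun i => u i - v i) atTop (𝓝 0)) :
    liminf (fun i => (v i : EReal)) atTop ≤ liminf (fun i => (u i : EReal)) atTop := by
  have h0 : liminf (fun i => ((u i - v i : ℝ) : EReal)) atTop = 0 :=
    ((continuous_coe_real_ereal.tendsto 0).comp h).liminf_eq
  have he : (fun i => (u i : EReal)) =
      (fun i => ((u i - v i : ℝ) : EReal)) + fun i => (v i : EReal) := by
    ext i
    rw [Pi.add_apply, ← EReal.coe_add, sub_add_cancel]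
  rw [he]
  refine le_trans ?_ EReal.le_liminf_add
  rw [h0, zero_add]

variable {d : ℕ} {A : Type*} [MetricSpace A] [CompactSpace A] {pb : Problem d A}

theorem Problem.bddAbove_L (pb : Problem d A) {y : E d} (hy : y ∈ closure pb.Ω) (q : ℝ) (P : E d)
    (S : ℝ) : BddAbove (range fun α => pb.L α y q P S - pb.f α y) := by
  refine (isCompact_range ?_).bddAbove
  have ha := pb.a_family.continuous_apply hy
  have hb := pb.b_family.continuous_apply hy
  have hc := pb.c_family.continuous_apply hy
  have hf := pb.f_family.continuous_apply hy
  unfold Problem.L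
  fun_prop

theorem Problem.bddAbove_LB (pb : Problem d A) {y : E d} (hy : y ∈ frontier pb.Ω) (P : E d)
    (S : ℝ) : BddAbove (range fun α => pb.LB α y P S - pb.gB α y) := by
  refine (isCompact_range ?_).bddAbove
  have hb := pb.bB_family.continuous_apply hy
  have hc := pb.cB_family.continuous_apply hy
  have hf := pb.gB_family.continuous_apply hy
  unfold Problem.LB
  fun_prop

/-- The discrete operator applied to the projection of `ψ` is asymptotically the operator `F` at the
node, with the derivatives of `ψ` at the limit point. -/
theorem EllipticProjection.tendsto_discreteF_sub_F [Nonempty A] {D : Scheme pb}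
    (Q : EllipticProjection D) {ψ : ℝ × E d → ℝ} (hψ : ContDiff ℝ 2 ψ) {t : ℝ} (ht : t < pb.T)
    {x : E d} (hx : x ∈ closure pb.Ω) {k : ℕ → ℕ} {y : ℕ → E d}
    (hy : ∀ i, y i ∈ (D.mesh i).vertices)
    (hkt : Tendsto (fun i => D.s i (k i)) atTop (𝓝 t)) (hyx : Tendsto y atTop (𝓝 x)) :
    Tendsto (fun i => D.discreteF i (Q.apply i ψ hψ) (k i) (y i) -
      pb.F (t, y i, (jet ψ t x).2.2)) atTop (𝓝 0) := by
  rw [Metric.tendsto_nhds]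
  intro ε' hε'
  obtain ⟨ε, hε, hεε'⟩ := exists_between hε'
  obtain ⟨M, hM⟩ := D.bounded
  have hM0 : 0 ≤ M :=
    (abs_nonneg _).trans ((hM 0 (Classical.arbitrary A)).1 x hx).1
  set P := gradient (fun z => ψ (t, z)) x with hP
  set S := ψ (t, x) with hS
  set q := Laplacian.laplacian (fun z => ψ (t, z)) x with hq
  set r := deriv (fun s => ψ (s, x)) t with hr
  have hjet : (jet ψ t x).2.2 = (q, P, r, S) := rfl
  -- The constant of the interior row estimate, plus 1 for the discrete time derivative.
  set N := 6 * M + ‖P‖ + |S| + |q| + 2 with hN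
  have hN0 : 0 < N := by positivity
  set η := ε / N with hη
  have hη0 : 0 < η := div_pos hε hN0
  have hηN : η * N = ε := by rw [hη]; field_simp
  have hcpt : IsCompact (closure pb.Ω) := pb.domain.isBounded.isCompact_closure
  have hstep : ∀ i, D.s i (k i + 1) = D.s i (k i) + D.h i := fun i => by
    simp only [Scheme.s]
    push_cast
    ring
  have hkt' : Tendsto (fun i => D.s i (k i + 1)) atTop (𝓝 t) := by
    simp only [hstep]
    simpa using hkt.add D.h_tendsto
  have hut : ContDiff ℝ 1 fun z => ψ (t, z) :=
    (hψ.comp (contDiff_const.prodMk contDiff_id)).of_le (by norm_num)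
  have hudiff : Differentiable ℝ fun z => ψ (t, z) := hut.differentiable one_ne_zero
  have hτ := contDiff_time_deriv hψ t
  -- Half of `η` is spent on the projection error, the other half on the variation of `ψ` and its
  -- derivatives near `(t, x)`.
  have C₀ := Q.eventually_C1Bound (w := fun i => slice ψ hψ (D.s i (k i))) hut
    (fun ε hε => eventually_slice_close hψ hcpt hkt hε) (half_pos hη0)
  have C₁ := Q.eventually_C1Bound (w := fun i => slice ψ hψ (D.s i (k i + 1))) hut
    (fun ε hε => eventually_slice_close hψ hcpt hkt' hε) (half_pos hη0)
  have C₂ := Q.eventually_C1Bound (w := fun i => (D.h i)⁻¹ •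
      (slice ψ hψ (D.s i (k i) + D.h i) - slice ψ hψ (D.s i (k i)))) hτ
    (fun ε hε => eventually_quotient_close hψ hcpt hkt D.h_pos D.h_tendsto hε) (half_pos hη0)
  have hT : ∀ᶠ i in atTop, |deriv (fun s => ψ (s, y i)) t - r| ≤ η / 2 := by
    have := (hτ.continuous.tendsto x).comp hyx
    filter_upwards [this.eventually (Metric.closedBall_mem_nhds r (half_pos hη0))] with i hi
    exact hi
  have hloc : ∀ᶠ p in 𝓝 (t, x), ‖gradient (fun z => ψ (p.1, z)) p.2 - P‖ ≤ η / 2 ∧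
      |ψ p - S| ≤ η / 2 ∧ |Laplacian.laplacian (fun z => ψ (p.1, z)) p.2 - q| ≤ η := by
    have h1 := ((continuous_gradient_slice hψ).tendsto (t, x)).eventually
      (Metric.closedBall_mem_nhds _ (half_pos hη0))
    have h2 := (hψ.continuous.tendsto (t, x)).eventually
      (Metric.closedBall_mem_nhds _ (half_pos hη0))
    have h3 := ((continuous_laplacian_slice hψ).tendsto (t, x)).eventually
      (Metric.closedBall_mem_nhds _ hη0)
    filter_upwards [h1, h2, h3] with p k1 k2 k3
    rw [dist_eq_norm] at k1 k2 k3
    exact ⟨k1, k2, k3⟩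
  obtain ⟨ρ, hρ, hloc⟩ := Metric.eventually_nhds_iff.1 hloc
  have hyρ : ∀ᶠ i in atTop, dist (y i) x < ρ / 2 :=
    hyx.eventually (Metric.ball_mem_nhds x (half_pos hρ))
  have hmρ : ∀ᶠ i in atTop, meshSize (D.mesh i) < ρ / 2 :=
    D.meshSize_tendsto.eventually (Iio_mem_nhds (half_pos hρ))
  filter_upwards [C₀, C₁, C₂, hT, hyρ, hmρ, hkt.eventually (Metric.ball_mem_nhds t hρ),
    hkt'.eventually (Metric.ball_mem_nhds t hρ), D.a_conv η hη0,
    D.b_conv.eventually_norm_sub_le_of_dist pb.b_family pb.b_cont hcpt D.meshSize_tendsto hη0,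
    D.c_conv.eventually_norm_sub_le_of_dist pb.c_family pb.c_cont hcpt D.meshSize_tendsto hη0,
    D.f_conv.eventually_norm_sub_le_of_dist pb.f_family pb.f_cont hcpt D.meshSize_tendsto hη0,
    D.bB_conv.eventually_norm_sub_le hη0, D.cB_conv.eventually_norm_sub_le hη0,
    D.gB_conv.eventually_norm_sub_le hη0]
    with i c₀ c₁ c₂ hTi hyi hmi hs₀ hs₁ ha hb hc hf hbB hcB hgB
  have hycl : y i ∈ closure pb.Ω := D.vertices_subset_closure i (hy i)
  have hnear : ∀ s z, dist s t < ρ → dist z (y i) ≤ meshSize (D.mesh i) → dist (s, z) (t, x) < ρ := by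
    intro s z hs hz
    rw [Prod.dist_eq, max_lt_iff]
    exact ⟨hs, by linarith [dist_triangle z (y i) x]⟩
  have htt : dist t t < ρ := by simpa using hρ
  have hmesh0 : 0 ≤ meshSize (D.mesh i) := by
    obtain ⟨s, hs, hsc, hys⟩ := (D.isMesh i).exists_element
      (Geometry.SimplicialComplex.vertices_subset_space (hy i))
    exact Metric.diam_nonneg.trans ((D.isMesh i).diam_le_meshSize ⟨s, hs, hsc, rfl⟩)
  have hval : ∀ p ∈ D.V i, C1Bound pb.Ω (p - fun z => ψ (t, z)) (η / 2) → ∀ z ∈ closure pb.Ω,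
      dist z (y i) ≤ meshSize (D.mesh i) → |p z - S| ≤ η := by
    intro p hp hpu z hz hzy
    have h1 := C1Bound.abs_sub_le hp hut.continuous hpu hz
    have h2 := (hloc (hnear t z htt hzy)).2.1
    have := abs_sub_le (p z) (ψ (t, z)) S
    linarith
  have hgrad : ∀ p ∈ D.V i, C1Bound pb.Ω (p - fun z => ψ (t, z)) (η / 2) →
      ∀ᵐ z ∂(volume.restrict pb.Ω), dist z (y i) ≤ meshSize (D.mesh i) →
        ‖gradient p z - P‖ ≤ η ∧ |p z - S| ≤ η := by
    intro p hp hpu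
    filter_upwards [hpu.ae_norm_gradient_sub_le hudiff,
      ae_restrict_mem pb.domain.isOpen.measurableSet] with z hz hzΩ hzy
    refine ⟨?_, hval p hp hpu z (subset_closure hzΩ) hzy⟩
    have h2 := (hloc (hnear t z htt hzy)).1
    have := norm_sub_le_norm_sub_add_norm_sub (gradient p z) (gradient (fun z => ψ (t, z)) z) P
    linarith
  have helem : ∀ p ∈ D.V i, C1Bound pb.Ω (p - fun z => ψ (t, z)) (η / 2) →
      ∀ κ ∈ elements (D.mesh i), y i ∈ κ → ∀ l : E d →ᵃ[ℝ] ℝ, EqOn p l κ →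
        ‖affineGradient l - P‖ ≤ η := by
    intro p hp hpu κ hκ hyκ l hl
    obtain ⟨z, hz, hzl⟩ := hpu.exists_norm_affineGradient_sub_le hudiff hκ hl
    have h2 := (hloc (hnear t z htt ((D.isMesh i).dist_le_meshSize hκ hz hyκ))).1
    have := norm_sub_le_norm_sub_add_norm_sub (affineGradient l)
      (gradient (fun z => ψ (t, z)) z) P
    linarith
  have hdt : |(Q.apply i ψ hψ (D.s i (k i + 1)) (y i) - Q.apply i ψ hψ (D.s i (k i)) (y i)) / D.h i
      - r| ≤ η := by
    have h1 := C1Bound.abs_sub_le (Q.P i _).2 hτ.continuous c₂ hycl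
    -- By linearity the discrete time derivative of the projections is the projection of the
    -- difference quotient.
    have h2 : ((Q.P i ((D.h i)⁻¹ • (slice ψ hψ (D.s i (k i) + D.h i) -
        slice ψ hψ (D.s i (k i)))) : E d → ℝ)) (y i) =
        (Q.apply i ψ hψ (D.s i (k i + 1)) (y i) - Q.apply i ψ hψ (D.s i (k i)) (y i)) / D.h i := by
      rw [hstep, map_smul, map_sub, Submodule.coe_smul, Submodule.coe_sub, Pi.smul_apply,
        Pi.sub_apply, smul_eq_mul, div_eq_inv_mul]
      rfl
    rw [h2] at h1
    have := abs_sub_le ((Q.apply i ψ hψ (D.s i (k i + 1)) (y i) -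
      Q.apply i ψ hψ (D.s i (k i)) (y i)) / D.h i) (deriv (fun s => ψ (s, y i)) t) r
    linarith
  have hp₀ : Q.apply i ψ hψ (D.s i (k i)) ∈ D.V i := (Q.P i _).2
  have hp₁ : Q.apply i ψ hψ (D.s i (k i + 1)) ∈ D.V i := (Q.P i _).2
  have hyy : dist (y i) (y i) ≤ meshSize (D.mesh i) := by rwa [dist_self]
  refine lt_of_le_of_lt ?_ hεε'
  rw [Real.dist_eq, sub_zero, hjet]
  -- Slack for the boundary rows, whose estimates have smaller constants than `N`.
  have hext : 0 ≤ η * (2 * M) := by positivity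
  have hext' : 0 ≤ η * |q| := by positivity
  have hext'' : 0 ≤ η * (‖P‖ + |S| + 4 * M) := by positivity
  have hFt : ∀ z : E d, pb.F (t, z, q, P, r, S) = _ := fun z => if_neg ht.ne
  by_cases hyΩ : y i ∈ pb.Ω
  · have hyD : y i ∉ pb.ΓD := fun h => by
      have : y i ∈ frontier pb.Ω := by
        rw [← pb.boundary_eq]
        exact Or.inl (Or.inl h)
      exact this.2 (by rwa [pb.domain.isOpen.interior_eq])
    have hyt : y i ∈ tsupport (D.φ i (y i)) := by
      refine subset_tsupport _ ?_
      rw [Function.mem_support, (D.isHat i _ (hy i)).2.1]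
      exact one_ne_zero
    have hrow := abs_ciSup_sub_ciSup_le (pb.bddAbove_L hycl q P S) fun α =>
      Q.abs_row_interior_sub_le (hy i) hyΩ (hM i α).1 (hgrad _ hp₀ c₀) (hgrad _ hp₁ c₁)
        (fun z hz => ⟨(hloc (hnear _ z hs₀ hz)).2.2, (hloc (hnear _ z hs₁ hz)).2.2⟩)
        (ha α (y i) (hy i) hyD (y i) hyt)
        (fun z hz hzy => ⟨hb α _ hycl z (subset_closure hz) hzy,
          hc α _ hycl z (subset_closure hz) hzy, hf α _ hycl z (subset_closure hz) hzy⟩)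
    rw [hFt, if_pos hyΩ, Scheme.discreteF, Scheme.dt, if_pos (mem_union_left _ hyΩ)]
    rw [abs_le] at hrow hdt ⊢
    rw [← hηN, hN]
    unfold EllipticProjection.apply at hdt ⊢
    constructor <;> linarith [hrow.1, hrow.2, hdt.1, hdt.2]
  have hyF : y i ∈ frontier pb.Ω := ⟨hycl, by rwa [pb.domain.isOpen.interior_eq]⟩
  by_cases hyB : y i ∈ pb.Γt ∪ pb.ΓR
  · have hrow := abs_ciSup_sub_ciSup_le (pb.bddAbove_LB hyF P S) fun α =>
      D.abs_row_boundary_sub_le (hy i) hyB hp₀ hp₁ (hM i α).2 (helem _ hp₀ c₀) (helem _ hp₁ c₁)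
        (hval _ hp₀ c₀ _ hycl hyy) (hval _ hp₁ c₁ _ hycl hyy) (hbB α _ hyF) (hcB α _ hyF)
        (hgB α _ hyF)
    rw [hFt, if_neg hyΩ, Scheme.discreteF, Scheme.dt]
    rw [abs_le] at hrow hdt ⊢
    rw [← hηN, hN]
    by_cases hyt : y i ∈ pb.Γt
    · rw [if_pos hyt, if_pos (mem_union_right _ hyt)]
      constructor <;> linarith [hrow.1, hrow.2, hdt.1, hdt.2]
    · have hyU : y i ∉ pb.Ω ∪ pb.Γt := not_or.2 ⟨hyΩ, hyt⟩
      rw [if_neg hyt, if_pos (hyB.resolve_left hyt), if_neg hyU]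
      constructor <;> linarith [hrow.1, hrow.2]
  · have hyt : y i ∉ pb.Γt := fun h => hyB (Or.inl h)
    have hyU : y i ∉ pb.Ω ∪ pb.Γt := not_or.2 ⟨hyΩ, hyt⟩
    have hyR : y i ∉ pb.ΓR := fun h => hyB (Or.inr h)
    have hyD : y i ∈ pb.ΓD := by
      have := hyF
      rw [← pb.boundary_eq] at this
      rcases this with (h | h) | h
      exacts [h, absurd h hyR, absurd h hyt]
    -- At a Dirichlet node the row is `w(y) - g(y)` without dependence on `α`, so the supremum is
    -- that of a constant and only the nodal value has to converge.
    have hrow := hval _ hp₀ c₀ _ hycl hyy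
    rw [hFt, if_neg hyΩ, if_neg hyt, if_neg hyR, Scheme.discreteF, Scheme.dt,
      if_neg hyU]
    simp only [Scheme.opE, Scheme.opI, Scheme.opF, Scheme.opEΩ, Scheme.opIΩ, Scheme.opFΩ,
      Scheme.opEB, Scheme.opIB, Scheme.opFB, if_neg hyΩ, if_neg hyB, if_pos hyD, zero_add,
      ciSup_const]
    rw [abs_le] at hrow ⊢
    rw [← hηN, hN]
    constructor <;> linarith [hrow.1, hrow.2]

end Consistency

end HJB

theorem theorem6p1 {d : ℕ} (hd : 2 ≤ d) {A : Type*} [MetricSpace A] [CompactSpace A] [Nonempty A]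
    (pb : HJB.Problem d A) (D : HJB.Scheme pb) (Q : HJB.EllipticProjection D)
    (ψ : ℝ × HJB.E d → ℝ) (hψ : ContDiff ℝ 2 ψ)
    (t : ℝ) (ht : t ∈ Set.Ico 0 pb.T) (x : HJB.E d) (hx : x ∈ closure pb.Ω)
    (k : ℕ → ℕ) (hk : ∀ i, k i ≤ D.steps i)
    (y : ℕ → HJB.E d) (hy : ∀ i, y i ∈ (D.mesh i).vertices)
    (hkt : Filter.Tendsto (fun i => D.s i (k i)) Filter.atTop (nhds t))
    (hyx : Filter.Tendsto y Filter.atTop (nhds x)) :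
    Filter.limsup (fun i => ((D.discreteF i (Q.apply i ψ hψ) (k i) (y i) : ℝ) : EReal))
        Filter.atTop ≤ pb.upperF (HJB.jet ψ t x) ∧
      pb.lowerF (HJB.jet ψ t x) ≤
        Filter.liminf (fun i => ((D.discreteF i (Q.apply i ψ hψ) (k i) (y i) : ℝ) : EReal))
          Filter.atTop := by
  have hlim := Q.tendsto_discreteF_sub_F hψ ht.2 hx hy hkt hyx
  -- Only the node moves, and it stays in the closed domain; `t < T` has been used in `hlim` to
  -- avoid the final time branch of `F`.
  have hz : Tendsto (fun i => (t, y i, (HJB.jet ψ t x).2.2)) atTop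
      (𝓝[pb.argSet] (HJB.jet ψ t x)) := by
    refine tendsto_nhdsWithin_iff.2 ⟨?_, Eventually.of_forall fun i =>
      ⟨⟨ht.1, ht.2.le⟩, D.vertices_subset_closure i (hy i)⟩⟩
    exact tendsto_const_nhds.prodMk_nhds (hyx.prodMk_nhds tendsto_const_nhds)
  constructor
  · refine (HJB.limsup_coe_le_of_tendsto_sub hlim).trans ?_
    exact limsup_le_limsup_of_le (u := fun z' => ((pb.F z' : ℝ) : EReal)) hz
  · refine le_trans ?_ (HJB.le_liminf_coe_of_tendsto_sub hlim)
    exact liminf_le_liminf_of_le (u := fun z' => ((pb.F z' : ℝ) : EReal)) hz
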